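/- Let $M=\{M(t)\}_{t\ge 0}$ be a continuous-time Markov chain with states $\{1,\dots,r\}$, right-continuous step-function paths, an arbitrary initial law and constant transition intensities $q_{i,j}\ge 0$ ($i\neq j$), and let $Q$ be the $r\times r$ matrix with off-diagonal entries $q_{i,j}$ and diagonal entries $-\sum_{j\ne i}q_{i,j}$. Let $\lambda_1,\dots,\lambda_r\ge 0$, $\Lambda=\mathrm{diag}(\lambda_1,\dots,\lambda_r)$, and let $\gamma:[0,\infty)\to[0,\infty)$ (the exposure) be of bounded variation on every bounded interval. Let $N=\{N(t)\}_{t\ge 0}$ be a right-continuous counting process with $N(0)=0$ which, conditionally on the path of $M$, has independent increments such that $N(b)-N(a)$ is Poisson with mean $\int_a^b\lambda_{M(u)}\gamma(u)\,du$ for all $0\le a\le b$; that is, $(M,N)$ is a Markov-modulated non-homogeneous Poisson process. Let $t\ge 0$ and $t^*>0$. Assume that $\gamma$ is equal to a constant $\gamma_{t^*}$ on $[t,t+t^*)$ and is right-continuous at $t+t^*$, with value $\gamma_{t+t^*}:=\gamma(t+t^*)$ there (for instance, $\gamma$ is piecewise constant and right-continuous, and has no change point in $(t,t+t^*)$). Then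 the matrix of transition densities for regime transitions with exactly one event arrival, at time $t+t^*$, given the regime at time $t$, is $$\boldsymbol f(t,t^*)=\exp\left[(Q-\Lambda\gamma_{t^*})\,t^*\right]\Lambda\,\gamma_{t+t^*}.$$ This means the following. For all regimes $i,j$ and all $n\ge 0$ with $\mathbb P[M(t)=i,N(t)=n]>0$: (a) for $0<s\le t^*$ let $\boldsymbol f(t,s)=\exp[(Q-\Lambda\gamma_{t^*})s]\,\Lambda\,\gamma(t+s)$. For every Borel set $B\subseteq(0,t^*]$, the conditional probability, given $M(t)=i$ and $N(t)=n$, that the first arrival after time $t$ occurs at a time $t+s$ with $s\in B$, that exactly one event arrives at that time, and that $M(t+s)=j$, is equal to $\int_B f_{i,j}(t,s)\,ds$; (b) $\displaystyle f_{i,j}(t,t^*)=\lim_{h\downarrow 0}\frac1h\,\mathbb P\left[N((t+t^*)^-)=n,\ N(t+t^*+h)=n+1,\ M(t+t^*+h)=j\,\middle|\,M(t)=i,N(t)=n\right]$; (c) $\displaystyle f_{i,j}(t,t^*)=\lim_{h\downarrow 0}\mathbb P\left[M(t+t^*)=j,\,N((t+t^*)^-)=n\,\middle|\,M(t)=i,N(t)=n\right]\cdot\frac1h\,\mathbb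 P\left[M(t+t^*+h)=j,\,N(t+t^*+h)=n+1\,\middle|\,M(t+t^*)=j,\,N((t+t^*)^-)=n\right]$, where the second conditional probability is read as $0$ if its condition has probability $0$. -/

import Mathlib

open MeasureTheory Filter Topology Set

noncomputable section

/-- `Q` is a matrix of transition intensities (a generator): `Q i j ≥ 0` for `i ≠ j`, and
`Q i i = - q_i` with `q_i = ∑_{j ≠ i} Q i j`. -/
structure IsIntensityMatrix {r : ℕ} (Q : Matrix (Fin r) (Fin r) ℝ) : Prop where
  offDiag_nonneg : ∀ i j, i ≠ j → 0 ≤ Q i j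
  diag : ∀ i, Q i i = - ∑ j ∈ Finset.univ.erase i, Q i j

/-- `P` is a stationary Markov transition function on the states `Fin r` (only the values `P t`
with `0 ≤ t` matter) whose transition intensities are the off-diagonal entries of `Q`. -/
structure IsTransitionFunction {r : ℕ} (Q : Matrix (Fin r) (Fin r) ℝ)
    (P : ℝ → Matrix (Fin r) (Fin r) ℝ) : Prop where
  nonneg : ∀ t, 0 ≤ t → ∀ i j, 0 ≤ P t i j
  row_sum : ∀ t, 0 ≤ t → ∀ i, ∑ j, P t i j = 1
  zero : P 0 = 1
  add : ∀ s t, 0 ≤ s → 0 ≤ t → P (s + t) = P s * P t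
  intensity : ∀ i j, i ≠ j → Tendsto (fun h : ℝ => P h i j / h) (𝓝[>] 0) (𝓝 (Q i j))

/-- `M = (M t)_{t ≥ 0}` is a continuous-time Markov chain with state space `Fin r`, constant
stationary transition intensities `Q`, arbitrary initial law, and paths that are
right-continuous step functions. Only the times `t ≥ 0` matter. -/
structure IsMarkovChain {Ω : Type*} [MeasurableSpace Ω] (μ : Measure Ω) {r : ℕ}
    (Q : Matrix (Fin r) (Fin r) ℝ) (M : ℝ → Ω → Fin r) : Prop where
  measurable : ∀ t, 0 ≤ t → Measurable (M t)
  rightCont : ∀ ω t, 0 ≤ t → ∀ᶠ u in 𝓝[>] t, M u ω = M t ω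
  leftLim : ∀ ω t, 0 < t → ∃ i, ∀ᶠ u in 𝓝[<] t, M u ω = i
  intensityMatrix : IsIntensityMatrix Q
  markov : ∃ P : ℝ → Matrix (Fin r) (Fin r) ℝ, IsTransitionFunction Q P ∧
    ∀ (k : ℕ) (s : Fin (k + 1) → ℝ), Monotone s → 0 ≤ s 0 → ∀ x : Fin (k + 1) → Fin r,
      μ.real {ω | ∀ l, M (s l) ω = x l} =
        μ.real {ω | M (s 0) ω = x 0} *
          ∏ l : Fin k, P (s l.succ - s l.castSucc) (x l.castSucc) (x l.succ)

/-- The σ-algebra generated by the whole path `(M t)_{t ≥ 0}`. -/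
abbrev pathSigma {Ω : Type*} {r : ℕ} (M : ℝ → Ω → Fin r) : MeasurableSpace Ω :=
  ⨆ (t : ℝ) (_ : 0 ≤ t), MeasurableSpace.comap (M t) inferInstance

/-- The cumulative intensity `∫_a^b λ_{M(u)} γ(u) du`. -/
def cumIntensity {Ω : Type*} {r : ℕ} (lam : Fin r → ℝ) (γ : ℝ → ℝ) (M : ℝ → Ω → Fin r)
    (a b : ℝ) (ω : Ω) : ℝ :=
  ∫ u in a..b, lam (M u ω) * γ u

/-- `(M, N)` is a Markov-modulated non-homogeneous Poisson process with regime intensities `Q`,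
event intensities `lam` and exposure `γ`: `M` is a Markov chain with intensities `Q`, `N` is a
counting process started at `0`, and conditionally on the path of `M`, `N` has independent
Poisson increments with parameters `∫ λ_{M(u)} γ(u) du`. -/
structure IsMMNPP {Ω : Type*} [MeasurableSpace Ω] (μ : Measure Ω) {r : ℕ}
    (Q : Matrix (Fin r) (Fin r) ℝ) (lam : Fin r → ℝ) (γ : ℝ → ℝ)
    (M : ℝ → Ω → Fin r) (N : ℝ → Ω → ℕ) : Prop where
  chain : IsMarkovChain μ Q M
  lam_nonneg : ∀ i, 0 ≤ lam i
  measurable : ∀ t, 0 ≤ t → Measurable (N t)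
  start : ∀ ω, N 0 ω = 0
  mono : ∀ ω s t, 0 ≤ s → s ≤ t → N s ω ≤ N t ω
  rightCont : ∀ ω t, 0 ≤ t → ∀ᶠ u in 𝓝[>] t, N u ω = N t ω
  poisson : ∀ (k : ℕ) (s : Fin (k + 1) → ℝ), Monotone s → 0 ≤ s 0 → ∀ z : Fin k → ℕ,
    μ[({ω | ∀ l : Fin k, N (s l.succ) ω = N (s l.castSucc) ω + z l}).indicator
        (fun _ => (1 : ℝ)) | pathSigma M]
      =ᵐ[μ] fun ω => ∏ l : Fin k,
        Real.exp (- cumIntensity lam γ M (s l.castSucc) (s l.succ) ω) *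
          cumIntensity lam γ M (s l.castSucc) (s l.succ) ω ^ z l / ((z l).factorial : ℝ)

/-- The matrix `exp[(Q - Λ c) s] Λ g`, where `Λ = diag(lam)`, `c` is the exposure on the
inter-arrival interval of length `s`, and `g` is the exposure at its end. -/
def mmnppDensity {r : ℕ} (Q : Matrix (Fin r) (Fin r) ℝ) (lam : Fin r → ℝ) (c g s : ℝ) :
    Matrix (Fin r) (Fin r) ℝ :=
  NormedSpace.exp (s • (Q - c • Matrix.diagonal lam)) * (g • Matrix.diagonal lam)

/-- The event `{M(t) = i, N(t) = n}`. -/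
def stateEvent {Ω : Type*} {r : ℕ} (M : ℝ → Ω → Fin r) (N : ℝ → Ω → ℕ)
    (t : ℝ) (i : Fin r) (n : ℕ) : Set Ω :=
  {ω | M t ω = i ∧ N t ω = n}

/-- The event `{N(t-) = n}`. -/
def leftCountEvent {Ω : Type*} (N : ℝ → Ω → ℕ) (t : ℝ) (n : ℕ) : Set Ω :=
  {ω | ∀ᶠ u in 𝓝[<] t, N u ω = n}

/-- The event that, for some `s ∈ B`, the first arrival after time `t` occurs at time `t + s`,
exactly one event arrives at that time, and the regime is then `j`. -/
def nextArrivalEvent {Ω : Type*} {r : ℕ} (M : ℝ → Ω → Fin r) (N : ℝ → Ω → ℕ)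
    (t : ℝ) (B : Set ℝ) (j : Fin r) : Set Ω :=
  {ω | ∃ s ∈ B, (∀ u ∈ Ico t (t + s), N u ω = N t ω) ∧ N (t + s) ω = N t ω + 1 ∧
    M (t + s) ω = j}

end

/-! Conditionally on the path of `M`, the counts of `N` over disjoint intervals are independent
Poisson variables. On the window after `t` the exposure is the constant `c`, so given the path the
probability of `{M t = i, N t = n}` followed by no event up to `t + s` is `W * exp (-c ∫ λ_{M(u)}
du)`, the integral running over `[t, t + s]`. The weight `W` (`stateWeight`) depends only on the
path up to `t`. Everything reduces to the row vector `v s` with entries `v s j = E[W exp (-c ∫ λ_M);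
M (t + s) = j]` (`discountedMean`).

The Markov property (`setIntegral_transition`) and the infinitesimal behaviour of the transition
function and of the discount show that the right derivative of `v` is `v B`, where `B = Q - cΛ`.
With continuity this gives the Feynman–Kac formula `v s = v 0 * exp (s B)` (`discountedMean_eq`).
Since `W` lives on `{M t = i}`, `v 0` is the probability of the conditioning event times the `i`-th
unit vector; dividing by it leaves row `i` of `exp (s B)`.

For the two pointwise limits, one event in a window of length `h` after `t + s` has conditional
probability asymptotic to `h λ_j γ (t + s)` when the regime is `j`, by right continuity of the path
and of `γ`; dominated convergence moves this inside the expectation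
(`tendsto_measureReal_arrival_div`). Left limits of `N` at a fixed time are almost surely its values
there.

For the law of the next arrival, the event that it falls in `(a, b]` is a pointwise limit of events
read off uniform grids. Given the path, their probabilities sum to Riemann–Stieltjes sums of the
discounted indicator against `c λ_M du`, with no error term (`measureReal_gridArrivalEvent`). The
limit and Fubini give the integral of `v u j * c λ_j` over `(a, b]`, and equality of measures on
half-open intervals extends this to Borel sets. -/

/-! ### Joint measurability of right-continuous processes. -/

theorem measurable_uncurry_of_rightCont {Ω : Type*} {mΩ : MeasurableSpace Ω} {X : ℝ → Ω → ℝ}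
    (hX : ∀ u, Measurable (X u))
    (hr : ∀ ω u, Tendsto (fun v => X v ω) (𝓝[>] u) (𝓝 (X u ω))) :
    Measurable (Function.uncurry X) := by
  -- Time is rounded up to the mesh `1 / (k + 1)`. Floor plus one, rather than ceiling, makes the
  -- rounded time strictly larger than `u`, so limits along `𝓝[>] u` suffice; the rounded process
  -- uses only countably many times.
  set p : ℕ → ℝ → ℝ := fun k u => ((⌊u * ((k : ℝ) + 1)⌋ : ℝ) + 1) / ((k : ℝ) + 1) with hp
  have hk : ∀ k : ℕ, (0 : ℝ) < (k : ℝ) + 1 := fun k => by positivity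
  have hp1 : ∀ k u, u < p k u := fun k u => by
    rw [hp, lt_div_iff₀ (hk k)]; exact Int.lt_floor_add_one _
  have hp2 : ∀ k u, p k u ≤ u + 1 / ((k : ℝ) + 1) := fun k u => by
    rw [hp, div_le_iff₀ (hk k), add_mul, div_mul_cancel₀ _ (hk k).ne']
    have := Int.floor_le (u * ((k : ℝ) + 1))
    linarith
  have hlim : ∀ u, Tendsto (fun k => p k u) atTop (𝓝[>] u) := fun u => by
    refine tendsto_nhdsWithin_iff.2 ⟨?_, Eventually.of_forall fun k => hp1 k u⟩
    refine tendsto_of_tendsto_of_tendsto_of_le_of_le tendsto_const_nhds ?_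
      (fun k => (hp1 k u).le) (fun k => hp2 k u)
    simpa using tendsto_const_nhds.add (tendsto_one_div_add_atTop_nhds_zero_nat (𝕜 := ℝ))
  refine measurable_of_tendsto_metrizable
    (f := fun k (q : ℝ × Ω) => X (p k q.1) q.2) (fun k => ?_) ?_
  · have h1 : Measurable (fun q : ℤ × Ω => X (((q.1 : ℝ) + 1) / ((k : ℝ) + 1)) q.2) :=
      measurable_from_prod_countable_right fun l => hX (((l : ℝ) + 1) / ((k : ℝ) + 1))
    have h2 : Measurable (fun q : ℝ × Ω => (⌊q.1 * ((k : ℝ) + 1)⌋, q.2)) := by fun_prop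
    exact h1.comp h2
  · exact tendsto_pi_nhds.2 fun q => (hr q.2 q.1).comp (hlim q.1)

/-! ### Uniform subdivisions and Riemann–Stieltjes sums. -/

/-- The `l`-th point of the uniform subdivision of `[a, b]` into `k + 1` intervals. -/
noncomputable def gridPoint (a b : ℝ) (k : ℕ) (l : ℝ) : ℝ := a + (b - a) * (l / ((k : ℝ) + 1))

/-- The smallest point of the uniform subdivision that is at least `u`. -/
noncomputable def gridCeil (a b : ℝ) (k : ℕ) (u : ℝ) : ℝ :=
  gridPoint a b k (⌈(u - a) / (b - a) * ((k : ℝ) + 1)⌉ : ℤ)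

section Grid

variable {a b : ℝ} {k : ℕ}

theorem gridPoint_mono (hab : a ≤ b) {l m : ℝ} (h : l ≤ m) :
    gridPoint a b k l ≤ gridPoint a b k m := by
  have : 0 ≤ b - a := sub_nonneg.2 hab
  unfold gridPoint; gcongr

@[simp] theorem gridPoint_zero : gridPoint a b k 0 = a := by simp [gridPoint]

@[simp] theorem gridPoint_last : gridPoint a b k ((k : ℝ) + 1) = b := by
  have : (k : ℝ) + 1 ≠ 0 := by positivity
  simp [gridPoint, this]

theorem gridPoint_lt_iff (hab : a < b) {l u : ℝ} :
    gridPoint a b k l < u ↔ l < (u - a) / (b - a) * ((k : ℝ) + 1) := by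
  have h1 : 0 < b - a := sub_pos.2 hab
  have h2 : (0 : ℝ) < (k : ℝ) + 1 := by positivity
  rw [← div_lt_iff₀ h2, lt_div_iff₀ h1, gridPoint, lt_sub_iff_add_lt']
  rw [mul_comm]

theorem le_gridPoint_iff (hab : a < b) {l u : ℝ} :
    u ≤ gridPoint a b k l ↔ (u - a) / (b - a) * ((k : ℝ) + 1) ≤ l := by
  rw [← not_lt, gridPoint_lt_iff hab, not_lt]

theorem exists_mem_Ioc_gridPoint (hab : a < b) (k : ℕ) {u : ℝ} (hu : u ∈ Ioc a b) :
    ∃ l ∈ Finset.range (k + 1), u ∈ Ioc (gridPoint a b k l) (gridPoint a b k ((l : ℝ) + 1)) := by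
  set y := (u - a) / (b - a) * ((k : ℝ) + 1) with hy
  have h1 : 0 < b - a := sub_pos.2 hab
  have hy0 : 0 < y := by
    have : 0 < u - a := sub_pos.2 hu.1
    positivity
  have hy1 : y ≤ (k : ℝ) + 1 := by
    have := (le_gridPoint_iff (k := k) (l := (k : ℝ) + 1) (u := u) hab).1
      (by rw [gridPoint_last]; exact hu.2)
    exact this
  have hc : 0 < ⌈y⌉₊ := Nat.ceil_pos.2 hy0
  obtain ⟨l, hl⟩ : ∃ l, ⌈y⌉₊ = l + 1 := ⟨_, (Nat.succ_pred_eq_of_pos hc).symm⟩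
  refine ⟨l, ?_, ?_, ?_⟩
  · have : ⌈y⌉₊ ≤ k + 1 := Nat.ceil_le.2 (by push_cast; exact hy1)
    rw [Finset.mem_range]; omega
  · rw [gridPoint_lt_iff hab]; exact Nat.lt_ceil.1 (by rw [hl]; exact l.lt_succ_self)
  · rw [le_gridPoint_iff hab]
    have := Nat.le_ceil y
    rw [hl] at this; push_cast at this; exact this

theorem gridCeil_eq (hab : a < b) {l : ℕ} {u : ℝ}
    (hu : u ∈ Ioc (gridPoint a b k l) (gridPoint a b k ((l : ℝ) + 1))) :
    gridCeil a b k u = gridPoint a b k ((l : ℝ) + 1) := by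
  have : ⌈(u - a) / (b - a) * ((k : ℝ) + 1)⌉ = (l : ℤ) + 1 := by
    rw [Int.ceil_eq_iff]
    push_cast
    refine ⟨?_, (le_gridPoint_iff hab).1 hu.2⟩
    rw [add_sub_cancel_right]; exact (gridPoint_lt_iff hab).1 hu.1
  rw [gridCeil, this]; push_cast; rfl

theorem le_gridCeil (hab : a < b) (k : ℕ) (u : ℝ) : u ≤ gridCeil a b k u :=
  (le_gridPoint_iff hab).2 (Int.le_ceil _)

theorem gridCeil_le (hab : a < b) {u : ℝ} (hu : u ∈ Ioc a b) : gridCeil a b k u ≤ b := by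
  obtain ⟨l, hl, h⟩ := exists_mem_Ioc_gridPoint hab k hu
  rw [gridCeil_eq hab h]
  have : (l : ℝ) + 1 ≤ (k : ℝ) + 1 := by
    have := Finset.mem_range.1 hl
    exact_mod_cast this
  simpa using gridPoint_mono (k := k) hab.le this

theorem tendsto_gridCeil (hab : a < b) (u : ℝ) :
    Tendsto (fun k => gridCeil a b k u) atTop (𝓝[≥] u) := by
  refine tendsto_nhdsWithin_iff.2 ⟨?_, Eventually.of_forall fun k => le_gridCeil hab k u⟩
  have h1 : 0 < b - a := sub_pos.2 hab
  have hlim : Tendsto (fun k : ℕ => u + (b - a) * (1 / ((k : ℝ) + 1))) atTop (𝓝 u) := by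
    simpa using tendsto_const_nhds.add
      ((tendsto_one_div_add_atTop_nhds_zero_nat (𝕜 := ℝ)).const_mul (b - a))
  refine tendsto_of_tendsto_of_tendsto_of_le_of_le tendsto_const_nhds hlim
    (fun k => le_gridCeil hab k u) (fun k => ?_)
  have h2 : (0 : ℝ) < (k : ℝ) + 1 := by positivity
  have h3 := (Int.ceil_lt_add_one ((u - a) / (b - a) * ((k : ℝ) + 1))).le
  have h4 := gridPoint_mono (k := k) hab.le h3
  refine h4.trans (le_of_eq ?_)
  simp only [gridPoint]
  field_simp
  ring

theorem measurable_comp_gridCeil (φ : ℝ → ℝ) : Measurable fun u => φ (gridCeil a b k u) := by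
  have h1 : Measurable fun l : ℤ => φ (gridPoint a b k l) := measurable_of_countable _
  have h2 : Measurable fun u : ℝ => ⌈(u - a) / (b - a) * ((k : ℝ) + 1)⌉ := by fun_prop
  exact h1.comp h2

/-- Riemann–Stieltjes sums with right end-points of a right-continuous bounded integrand. -/
theorem tendsto_sum_gridPoint_mul_integral {φ g : ℝ → ℝ} {C : ℝ} (hab : a ≤ b)
    (hφ : ∀ u ∈ Ioc a b, Tendsto φ (𝓝[≥] u) (𝓝 (φ u))) (hC : ∀ u ∈ Ioc a b, |φ u| ≤ C)
    (hg : IntervalIntegrable g volume a b) :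
    Tendsto (fun k : ℕ => ∑ l ∈ Finset.range (k + 1), φ (gridPoint a b k ((l : ℝ) + 1)) *
        ∫ u in (gridPoint a b k l)..(gridPoint a b k ((l : ℝ) + 1)), g u) atTop
      (𝓝 (∫ u in a..b, φ u * g u)) := by
  rcases hab.eq_or_lt with rfl | hab
  · simp [gridPoint]
  have hbd : ∀ k u, u ∈ Ioc a b → |φ (gridCeil a b k u)| ≤ C := fun k u hu =>
    hC _ ⟨hu.1.trans_le (le_gridCeil hab k u), gridCeil_le hab hu⟩
  have hint : ∀ k, IntervalIntegrable (fun u => φ (gridCeil a b k u) * g u) volume a b := by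
    intro k
    rw [intervalIntegrable_iff_integrableOn_Ioc_of_le hab.le] at hg ⊢
    refine Integrable.bdd_mul (c := C) hg (measurable_comp_gridCeil φ).aestronglyMeasurable ?_
    filter_upwards [ae_restrict_mem measurableSet_Ioc] with u hu using hbd k u hu
  -- On each cell `gridCeil` is constantly the right end-point, so the sum is exactly one integral
  -- with `φ` evaluated at `gridCeil`; only dominated convergence remains.
  have key : ∀ k : ℕ, ∑ l ∈ Finset.range (k + 1), φ (gridPoint a b k ((l : ℝ) + 1)) *
        ∫ u in (gridPoint a b k l)..(gridPoint a b k ((l : ℝ) + 1)), g u =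
      ∫ u in a..b, φ (gridCeil a b k u) * g u := by
    intro k
    have hsub : ∀ l < k + 1, uIcc (gridPoint a b k l) (gridPoint a b k ((l : ℝ) + 1)) ⊆
        uIcc a b := by
      intro l hl
      rw [uIcc_of_le (gridPoint_mono hab.le (by linarith)), uIcc_of_le hab.le]
      refine Icc_subset_Icc ?_ ?_
      · have := gridPoint_mono (k := k) hab.le (l.cast_nonneg (α := ℝ))
        simpa using this
      · have : (l : ℝ) + 1 ≤ (k : ℝ) + 1 := by exact_mod_cast hl
        simpa using gridPoint_mono (k := k) hab.le this
    have := intervalIntegral.sum_integral_adjacent_intervals (n := k + 1)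
      (a := fun l : ℕ => gridPoint a b k l) (f := fun u => φ (gridCeil a b k u) * g u)
      (μ := volume) (fun l hl => by
        push_cast
        exact (hint k).mono_set (hsub l hl))
    push_cast at this
    rw [gridPoint_zero, gridPoint_last] at this
    rw [← this]
    refine Finset.sum_congr rfl fun l hl => ?_
    rw [← intervalIntegral.integral_const_mul]
    refine intervalIntegral.integral_congr_ae (Eventually.of_forall fun u hu => ?_)
    rw [uIoc_of_le (gridPoint_mono hab.le (by linarith))] at hu
    simp only [gridCeil_eq hab hu]
  simp_rw [key]
  refine intervalIntegral.tendsto_integral_filter_of_dominated_convergence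
    (fun u => C * |g u|) (Eventually.of_forall fun k => ?_) (Eventually.of_forall fun k => ?_)
    (hg.abs.const_mul C) (Eventually.of_forall fun u hu => ?_)
  · rw [uIoc_of_le hab.le]; exact (hint k).1.aestronglyMeasurable
  · refine Eventually.of_forall fun u hu => ?_
    rw [uIoc_of_le hab.le] at hu
    rw [norm_mul]
    exact mul_le_mul_of_nonneg_right (hbd k u hu) (norm_nonneg _)
  · rw [uIoc_of_le hab.le] at hu
    exact ((hφ u hu).comp (tendsto_gridCeil hab u)).mul_const _

end Grid

/-! ### Regularity of the exposure. -/

/-- By the Jordan decomposition it suffices to treat functions monotone on `[0, ∞)`, and clamping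
the argument at `0` makes these monotone on the whole line. -/
theorem LocallyBoundedVariationOn.measurable_comp_max {γ : ℝ → ℝ}
    (h : LocallyBoundedVariationOn γ (Ici 0)) : Measurable fun u => γ (max u 0) := by
  obtain ⟨p, q, hp, hq, rfl⟩ := h.exists_monotoneOn_sub_monotoneOn
  have key : ∀ f : ℝ → ℝ, MonotoneOn f (Ici 0) → Measurable fun u => f (max u 0) :=
    fun f hf => Monotone.measurable fun u v huv =>
      hf (mem_Ici.2 (le_max_right _ _)) (mem_Ici.2 (le_max_right _ _)) (max_le_max_right 0 huv)
  exact (key p hp).sub (key q hq)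

theorem LocallyBoundedVariationOn.exists_abs_le {γ : ℝ → ℝ}
    (h : LocallyBoundedVariationOn γ (Ici 0)) (R : ℝ) :
    ∃ K, 0 ≤ K ∧ ∀ u ∈ Icc 0 R, |γ u| ≤ K := by
  obtain ⟨p, q, hp, hq, rfl⟩ := h.exists_monotoneOn_sub_monotoneOn
  refine ⟨|p 0| + |p R| + (|q 0| + |q R|), by positivity, fun u hu => ?_⟩
  have hR : (0 : ℝ) ≤ R := hu.1.trans hu.2
  have key : ∀ f : ℝ → ℝ, MonotoneOn f (Ici 0) → |f u| ≤ |f 0| + |f R| := fun f hf => by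
    have h1 := hf (mem_Ici.2 le_rfl) hu.1 hu.1
    have h2 := hf hu.1 (mem_Ici.2 hR) hu.2
    rw [abs_le]
    constructor
    · linarith [neg_abs_le (f 0), abs_nonneg (f R)]
    · linarith [le_abs_self (f R), abs_nonneg (f 0)]
  calc |(p - q) u| ≤ |p u| + |q u| := abs_sub _ _
    _ ≤ _ := add_le_add (key p hp) (key q hq)

theorem tendsto_integral_div_of_rightCont {f : ℝ → ℝ} {a b : ℝ} (hab : a < b)
    (hf : IntervalIntegrable f volume a b) (hc : ContinuousWithinAt f (Ici a) a) :
    Tendsto (fun h => (∫ u in a..(a + h), f u) / h) (𝓝[>] 0) (𝓝 (f a)) := by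
  have hm : StronglyMeasurableAtFilter f (𝓝[>] a) volume :=
    ⟨Ioc a b, Ioc_mem_nhdsGT hab, hf.1.aestronglyMeasurable⟩
  have h1 : HasDerivWithinAt (fun x => ∫ u in a..x, f u) (f a) (Ici a) a :=
    intervalIntegral.integral_hasDerivWithinAt_right (t := Ioi a) (by simp) hm
      (hc.mono Ioi_subset_Ici_self)
  have h2 := (hasDerivWithinAt_iff_tendsto_slope' (lt_irrefl a)).1 h1.Ioi_of_Ici
  have h3 : Tendsto (fun h : ℝ => a + h) (𝓝[>] 0) (𝓝[>] a) := by
    refine tendsto_nhdsWithin_iff.2 ⟨?_, ?_⟩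
    · have : Tendsto (fun h : ℝ => a + h) (𝓝 0) (𝓝 (a + 0)) := tendsto_const_nhds.add tendsto_id
      rw [add_zero] at this
      exact this.mono_left nhdsWithin_le_nhds
    · filter_upwards [self_mem_nhdsWithin] with h hh
      simpa using hh
  refine (h2.comp h3).congr fun h => ?_
  simp [slope_def_field]

/-- The σ-algebra generated by the path of `M` up to time `b`. -/
abbrev pastSigma {Ω : Type*} {r : ℕ} (M : ℝ → Ω → Fin r) (b : ℝ) : MeasurableSpace Ω :=
  ⨆ (t : ℝ) (_ : 0 ≤ t ∧ t ≤ b), MeasurableSpace.comap (M t) inferInstance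

/-- The properties of an exposure that are needed to integrate it: it is measurable, nonnegative
and locally bounded on `[0, ∞)`. -/
structure IsExposure (γ : ℝ → ℝ) : Prop where
  measurable : Measurable fun u => γ (max u 0)
  nonneg : ∀ u, 0 ≤ u → 0 ≤ γ u
  bounded : ∀ R, ∃ K, 0 ≤ K ∧ ∀ u ∈ Icc 0 R, γ u ≤ K

theorem IsExposure.const {c : ℝ} (hc : 0 ≤ c) : IsExposure fun _ => c :=
  ⟨measurable_const, fun _ _ => hc, fun _ => ⟨c, hc, fun _ _ => le_rfl⟩⟩

theorem LocallyBoundedVariationOn.isExposure {γ : ℝ → ℝ}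
    (h : LocallyBoundedVariationOn γ (Ici 0)) (h0 : ∀ u, 0 ≤ u → 0 ≤ γ u) : IsExposure γ := by
  refine ⟨h.measurable_comp_max, h0, fun R => ?_⟩
  obtain ⟨K, hK, hb⟩ := h.exists_abs_le R
  exact ⟨K, hK, fun u hu => (le_abs_self _).trans (hb u hu)⟩

section Path

variable {Ω : Type*} {r : ℕ} {M : ℝ → Ω → Fin r}

theorem pastSigma_mono {a b : ℝ} (h : a ≤ b) : pastSigma M a ≤ pastSigma M b :=
  iSup_mono fun _ => iSup_mono' fun hu => ⟨⟨hu.1, hu.2.trans h⟩, le_rfl⟩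

theorem pastSigma_le_pathSigma (b : ℝ) : pastSigma M b ≤ pathSigma M :=
  iSup_mono fun _ => iSup_mono' fun hu => ⟨hu.1, le_rfl⟩

theorem measurable_pastSigma {b u : ℝ} (h0 : 0 ≤ u) (hb : u ≤ b) :
    Measurable[pastSigma M b] (M u) :=
  Measurable.of_comap_le (le_iSup₂_of_le (f := fun (t : ℝ) (_ : 0 ≤ t ∧ t ≤ b) =>
    MeasurableSpace.comap (M t) inferInstance) u ⟨h0, hb⟩ le_rfl)

theorem measurableSet_pastSigma {b u : ℝ} (h0 : 0 ≤ u) (hb : u ≤ b) (j : Fin r) :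
    MeasurableSet[pastSigma M b] {ω | M u ω = j} :=
  measurable_pastSigma h0 hb (measurableSet_singleton j)

theorem cumIntensity_nonneg {lam : Fin r → ℝ}
    (hlam : ∀ i, 0 ≤ lam i) {γ : ℝ → ℝ} (hγ : IsExposure γ) {a b : ℝ} (ha : 0 ≤ a) (hab : a ≤ b)
    (ω : Ω) : 0 ≤ cumIntensity lam γ M a b ω :=
  intervalIntegral.integral_nonneg hab fun u hu => mul_nonneg (hlam _) (hγ.nonneg u (ha.trans hu.1))

end Path

theorem measurable_setIntegral_left {Ω : Type*} {m : MeasurableSpace Ω} {f : ℝ → Ω → ℝ}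
    (hf : Measurable (Function.uncurry f)) (s : Set ℝ) :
    Measurable fun ω => ∫ u in s, f u ω :=
  (StronglyMeasurable.integral_prod_left' (μ := volume.restrict s)
    hf.stronglyMeasurable).measurable

theorem exists_nonneg_bound {r : ℕ} (lam : Fin r → ℝ) : ∃ L, 0 ≤ L ∧ ∀ i, lam i ≤ L :=
  ⟨∑ i, |lam i|, by positivity, fun i => (le_abs_self _).trans
    (Finset.single_le_sum (f := fun i => |lam i|) (fun _ _ => abs_nonneg _) (Finset.mem_univ i))⟩

/-! ### Path regularity of the chain and the cumulative intensity. -/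

namespace IsMarkovChain

variable {Ω : Type*} [mΩ : MeasurableSpace Ω] {μ : Measure Ω} {r : ℕ}
  {Q : Matrix (Fin r) (Fin r) ℝ} {M : ℝ → Ω → Fin r}

theorem pathSigma_le (hM : IsMarkovChain μ Q M) : pathSigma M ≤ mΩ :=
  iSup₂_le fun t ht => (hM.measurable t ht).comap_le

theorem pastSigma_le (hM : IsMarkovChain μ Q M) (b : ℝ) : pastSigma M b ≤ mΩ :=
  (pastSigma_le_pathSigma b).trans hM.pathSigma_le

theorem measurableSet_eq (hM : IsMarkovChain μ Q M) {t : ℝ} (ht : 0 ≤ t) (j : Fin r) :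
    MeasurableSet {ω | M t ω = j} :=
  hM.measurable t ht (measurableSet_singleton j)

theorem eventually_nhdsGE (hM : IsMarkovChain μ Q M) (ω : Ω) {t : ℝ} (ht : 0 ≤ t) :
    ∀ᶠ u in 𝓝[≥] t, M u ω = M t ω := by
  rw [← Ioi_insert, nhdsWithin_insert, eventually_sup]
  exact ⟨rfl, hM.rightCont ω t ht⟩

theorem tendsto_nhdsGE (hM : IsMarkovChain μ Q M) (f : Fin r → ℝ) (ω : Ω) {t : ℝ} (ht : 0 ≤ t) :
    Tendsto (fun u => f (M u ω)) (𝓝[≥] t) (𝓝 (f (M t ω))) :=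
  tendsto_const_nhds.congr' ((hM.eventually_nhdsGE ω ht).mono fun u hu => by simp only [hu])

/-- Clamping time to `[a, b]` keeps right continuity while only the path up to `b` is consulted.
Joint measurability with respect to `pastSigma M b` is what makes the cumulative intensity adapted.
-/
theorem measurable_uncurry_clamp (hM : IsMarkovChain μ Q M) (f : Fin r → ℝ) {a b : ℝ}
    (ha : 0 ≤ a) (hab : a ≤ b) :
    Measurable[MeasurableSpace.prod inferInstance (pastSigma M b)]
      (Function.uncurry fun (u : ℝ) ω => f (M (min (max u a) b) ω)) := by
  have h0 : ∀ u, 0 ≤ min (max u a) b := fun u =>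
    le_min (ha.trans (le_max_right _ _)) (ha.trans hab)
  refine @measurable_uncurry_of_rightCont Ω (pastSigma M b) _ (fun u => ?_) (fun ω u => ?_)
  · exact (measurable_of_finite f).comp (measurable_pastSigma (h0 u) (min_le_right _ _))
  · refine (hM.tendsto_nhdsGE f ω (h0 u)).comp (tendsto_nhdsWithin_iff.2 ⟨?_, ?_⟩)
    · have : Continuous fun v : ℝ => min (max v a) b := by fun_prop
      exact (this.tendsto u).mono_left nhdsWithin_le_nhds
    · filter_upwards [self_mem_nhdsWithin] with v hv
      exact min_le_min_right _ (max_le_max_right _ (mem_Ioi.1 hv).le)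

theorem measurable_cumIntensity (hM : IsMarkovChain μ Q M) (lam : Fin r → ℝ) {γ : ℝ → ℝ}
    (hγ : IsExposure γ) {a b : ℝ} (ha : 0 ≤ a) (hab : a ≤ b) :
    Measurable[pastSigma M b] (cumIntensity lam γ M a b) := by
  have h1 := (hM.measurable_uncurry_clamp lam ha hab).mul
    (hγ.measurable.comp (@measurable_fst ℝ Ω _ (pastSigma M b)))
  have h2 := measurable_setIntegral_left (m := pastSigma M b)
    (f := fun u ω => lam (M (min (max u a) b) ω) * γ (max u 0)) h1 (Ioc a b)
  convert h2 using 1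
  funext ω
  rw [cumIntensity, intervalIntegral.integral_of_le hab]
  refine setIntegral_congr_fun measurableSet_Ioc fun u hu => ?_
  rw [max_eq_left hu.1.le, min_eq_left hu.2, max_eq_left (ha.trans hu.1.le)]

theorem measurable_path_mul (hM : IsMarkovChain μ Q M) (lam : Fin r → ℝ) {γ : ℝ → ℝ}
    (hγ : IsExposure γ) (ω : Ω) :
    Measurable fun u => lam (M (max u 0) ω) * γ (max u 0) := by
  refine Measurable.mul ?_ hγ.measurable
  -- A single path is treated as a process over a one-point space.
  have := @measurable_uncurry_of_rightCont Unit ⊤ (fun u _ => lam (M (max u 0) ω))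
    (fun u => measurable_const) (fun _ u => by
      refine (hM.tendsto_nhdsGE lam ω (le_max_right u 0)).comp (tendsto_nhdsWithin_iff.2 ⟨?_, ?_⟩)
      · have : Continuous fun v : ℝ => max v 0 := by fun_prop
        exact (this.tendsto u).mono_left nhdsWithin_le_nhds
      · filter_upwards [self_mem_nhdsWithin] with v hv
        exact max_le_max_right _ (mem_Ioi.1 hv).le)
  exact this.comp (g := Function.uncurry fun u _ => lam (M (max u 0) ω))
    (measurable_id.prodMk (measurable_const (a := ())) : Measurable fun u : ℝ => (u, ()))

theorem integrableOn_path_mul (hM : IsMarkovChain μ Q M) {lam : Fin r → ℝ} (hlam : ∀ i, 0 ≤ lam i)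
    {γ : ℝ → ℝ} (hγ : IsExposure γ) {a b : ℝ} (ha : 0 ≤ a) (ω : Ω) :
    IntegrableOn (fun u => lam (M u ω) * γ u) (Ioc a b) := by
  obtain ⟨L, hL0, hL⟩ := exists_nonneg_bound lam
  obtain ⟨K, hK0, hK⟩ := hγ.bounded b
  have h1 : IntegrableOn (fun u => lam (M (max u 0) ω) * γ (max u 0)) (Ioc a b) := by
    refine Measure.integrableOn_of_bounded (M := L * K) (by simp)
      (hM.measurable_path_mul lam hγ ω).aestronglyMeasurable ?_
    filter_upwards [ae_restrict_mem measurableSet_Ioc] with u hu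
    have hu0 : 0 ≤ u := ha.trans hu.1.le
    rw [max_eq_left hu0, Real.norm_of_nonneg (mul_nonneg (hlam _) (hγ.nonneg u hu0))]
    exact mul_le_mul (hL _) (hK u ⟨hu0, hu.2⟩) (hγ.nonneg u hu0) hL0
  refine h1.congr_fun (fun u hu => ?_) measurableSet_Ioc
  simp only [max_eq_left (ha.trans hu.1.le)]

theorem intervalIntegrable_path_mul (hM : IsMarkovChain μ Q M) {lam : Fin r → ℝ}
    (hlam : ∀ i, 0 ≤ lam i) {γ : ℝ → ℝ} (hγ : IsExposure γ) {a b : ℝ} (ha : 0 ≤ a) (hab : a ≤ b)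
    (ω : Ω) : IntervalIntegrable (fun u => lam (M u ω) * γ u) volume a b :=
  (intervalIntegrable_iff_integrableOn_Ioc_of_le hab).2 (hM.integrableOn_path_mul hlam hγ ha ω)

theorem cumIntensity_add (hM : IsMarkovChain μ Q M) {lam : Fin r → ℝ} (hlam : ∀ i, 0 ≤ lam i)
    {γ : ℝ → ℝ} (hγ : IsExposure γ) {a b d : ℝ} (ha : 0 ≤ a) (hab : a ≤ b) (hbd : b ≤ d) (ω : Ω) :
    cumIntensity lam γ M a b ω + cumIntensity lam γ M b d ω = cumIntensity lam γ M a d ω :=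
  intervalIntegral.integral_add_adjacent_intervals
    (hM.intervalIntegrable_path_mul hlam hγ ha hab ω)
    (hM.intervalIntegrable_path_mul hlam hγ (ha.trans hab) hbd ω)

theorem exists_cumIntensity_le (hM : IsMarkovChain μ Q M) {lam : Fin r → ℝ}
    (hlam : ∀ i, 0 ≤ lam i) {γ : ℝ → ℝ} (hγ : IsExposure γ) (R : ℝ) :
    ∃ K, 0 ≤ K ∧ ∀ a b ω, 0 ≤ a → a ≤ b → b ≤ R → cumIntensity lam γ M a b ω ≤ K * (b - a) := by
  obtain ⟨L, hL0, hL⟩ := exists_nonneg_bound lam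
  obtain ⟨K, hK0, hK⟩ := hγ.bounded R
  refine ⟨L * K, by positivity, fun a b ω ha hab hbR => ?_⟩
  have := intervalIntegral.integral_mono_on hab (hM.intervalIntegrable_path_mul hlam hγ ha hab ω)
    (intervalIntegrable_const (c := L * K)) (fun u hu =>
      mul_le_mul (hL _) (hK u ⟨ha.trans hu.1, hu.2.trans hbR⟩) (hγ.nonneg u (ha.trans hu.1)) hL0)
  refine this.trans (le_of_eq ?_)
  simp only [intervalIntegral.integral_const, smul_eq_mul]
  ring

theorem tendsto_cumIntensity_div (hM : IsMarkovChain μ Q M) {lam : Fin r → ℝ}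
    (hlam : ∀ i, 0 ≤ lam i) {γ : ℝ → ℝ} (hγ : IsExposure γ) {a : ℝ} (ha : 0 ≤ a)
    (hc : ContinuousWithinAt γ (Ici a) a) (ω : Ω) :
    Tendsto (fun h => cumIntensity lam γ M a (a + h) ω / h) (𝓝[>] 0)
      (𝓝 (lam (M a ω) * γ a)) :=
  tendsto_integral_div_of_rightCont (f := fun u => lam (M u ω) * γ u) (lt_add_one a)
    (hM.intervalIntegrable_path_mul hlam hγ ha (by linarith) ω)
    ((hM.tendsto_nhdsGE lam ω ha).mul hc)

/-- Integrals over a regime class just after time `s` converge to those over the class at `s`. -/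
theorem tendsto_setIntegral_regime [IsFiniteMeasure μ] (hM : IsMarkovChain μ Q M) {s : ℝ}
    (hs : 0 ≤ s) (j : Fin r) {F : ℝ → Ω → ℝ} {f : Ω → ℝ} {C : ℝ}
    (hFm : ∀ᶠ h in 𝓝[>] (0 : ℝ), Measurable (F h))
    (hFb : ∀ᶠ h in 𝓝[>] (0 : ℝ), ∀ ω, |F h ω| ≤ C)
    (hF : ∀ ω, Tendsto (fun h => F h ω) (𝓝[>] 0) (𝓝 (f ω))) :
    Tendsto (fun h => ∫ ω in {ω | M (s + h) ω = j}, F h ω ∂μ) (𝓝[>] 0)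
      (𝓝 (∫ ω in {ω | M s ω = j}, f ω ∂μ)) := by
  have hpos : ∀ᶠ h in 𝓝[>] (0 : ℝ), 0 < h := self_mem_nhdsWithin
  rw [← integral_indicator (hM.measurableSet_eq hs j)]
  have : ∀ᶠ h in 𝓝[>] (0 : ℝ), ∫ ω, {ω | M (s + h) ω = j}.indicator (F h) ω ∂μ =
      ∫ ω in {ω | M (s + h) ω = j}, F h ω ∂μ := by
    filter_upwards [hpos] with h hh
    rw [integral_indicator (hM.measurableSet_eq (by linarith) j)]
  refine Tendsto.congr' this ?_
  refine tendsto_integral_filter_of_dominated_convergence (fun _ => C) ?_ ?_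
    (integrable_const _) (Eventually.of_forall fun ω => ?_)
  · filter_upwards [hFm, hpos] with h hh h0
    exact (hh.indicator (hM.measurableSet_eq (by linarith) j)).aestronglyMeasurable
  · filter_upwards [hFb] with h hh
    exact Eventually.of_forall fun ω => (norm_indicator_le_norm_self _ _).trans (hh ω)
  · have h1 : Tendsto (fun h : ℝ => s + h) (𝓝[>] 0) (𝓝[>] s) := by
      refine tendsto_nhdsWithin_iff.2 ⟨?_, ?_⟩
      · have : Tendsto (fun h : ℝ => s + h) (𝓝 0) (𝓝 (s + 0)) :=
          tendsto_const_nhds.add tendsto_id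
        rw [add_zero] at this
        exact this.mono_left nhdsWithin_le_nhds
      · filter_upwards [self_mem_nhdsWithin] with h hh
        simpa using hh
    -- For each path the regime is frozen for small `h`, so the indicator of `{M (s + h) = j}` is
    -- eventually that of `{M s = j}` and only `F h` still varies.
    have h2 := h1.eventually (hM.rightCont ω s hs)
    by_cases hj : M s ω = j
    · rw [indicator_of_mem (by exact hj)]
      refine (hF ω).congr' ?_
      filter_upwards [h2] with h hh
      rw [indicator_of_mem (by exact hh.trans hj)]
    · rw [indicator_of_notMem (by exact hj)]
      refine tendsto_const_nhds.congr' ?_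
      filter_upwards [h2] with h hh
      rw [indicator_of_notMem]
      simpa [hh] using hj

end IsMarkovChain

/-! ### The Markov property relative to the whole past. -/

/-- The finite-dimensional laws of `M` are those of a Markov chain with transition function `P`. -/
def HasMarkovLaws {Ω : Type*} [MeasurableSpace Ω] (μ : Measure Ω) {r : ℕ} (M : ℝ → Ω → Fin r)
    (P : ℝ → Matrix (Fin r) (Fin r) ℝ) : Prop :=
  ∀ (k : ℕ) (s : Fin (k + 1) → ℝ), Monotone s → 0 ≤ s 0 → ∀ x : Fin (k + 1) → Fin r,
    μ.real {ω | ∀ l, M (s l) ω = x l} =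
      μ.real {ω | M (s 0) ω = x 0} *
        ∏ l : Fin k, P (s l.succ - s l.castSucc) (x l.castSucc) (x l.succ)

/-- Finite cylinders are the π-system on which the finite-dimensional laws can be compared; the
Markov property is extended from them to the whole past. -/
theorem pastSigma_eq_generateFrom {Ω : Type*} {r : ℕ} (M : ℝ → Ω → Fin r) (s : ℝ) :
    pastSigma M s = MeasurableSpace.generateFrom
      {E | ∃ I : Finset ℝ, (∀ u ∈ I, 0 ≤ u ∧ u ≤ s) ∧ ∃ x : ℝ → Fin r,
        E = {ω | ∀ u ∈ I, M u ω = x u}} := by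
  refine le_antisymm (iSup₂_le fun u hu => ?_) (MeasurableSpace.generateFrom_le ?_)
  · rw [← measurable_iff_comap_le]
    refine @measurable_to_countable' _ _ _ _ (_) _ fun j => ?_
    exact MeasurableSpace.measurableSet_generateFrom
      ⟨{u}, fun v hv => by rw [Finset.mem_singleton.1 hv]; exact hu, fun _ => j, by ext; simp⟩
  · rintro E ⟨I, hI, x, rfl⟩
    have : {ω | ∀ u ∈ I, M u ω = x u} = ⋂ u ∈ I, {ω | M u ω = x u} := by ext; simp
    rw [this]
    exact Finset.measurableSet_biInter (m := pastSigma M s) I fun u hu =>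
      measurableSet_pastSigma (hI u hu).1 (hI u hu).2 _

section Markov

variable {Ω : Type*} [mΩ : MeasurableSpace Ω] {μ : Measure Ω} {r : ℕ}
  {Q : Matrix (Fin r) (Fin r) ℝ} {M : ℝ → Ω → Fin r} {P : ℝ → Matrix (Fin r) (Fin r) ℝ}

/-- Appending one later time multiplies the product formula by one further transition factor. -/
theorem HasMarkovLaws.measureReal_snoc (hP : HasMarkovLaws μ M P) {k : ℕ} {τ : Fin (k + 1) → ℝ}
    (hτ : Monotone τ) (h0 : 0 ≤ τ 0) (x : Fin (k + 1) → Fin r) {u : ℝ} (hu : τ (Fin.last k) ≤ u)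
    (j : Fin r) :
    μ.real ({ω | ∀ l, M (τ l) ω = x l} ∩ {ω | M u ω = j}) =
      P (u - τ (Fin.last k)) (x (Fin.last k)) j * μ.real {ω | ∀ l, M (τ l) ω = x l} := by
  have hmono : Monotone (Fin.snoc τ u : Fin (k + 2) → ℝ) := by
    rw [Fin.monotone_iff_le_succ]
    intro i
    refine Fin.lastCases ?_ (fun i => ?_) i
    · rw [Fin.succ_last, Fin.snoc_last, Fin.snoc_castSucc]; exact hu
    · rw [Fin.succ_castSucc, Fin.snoc_castSucc, Fin.snoc_castSucc]
      exact hτ (Fin.castSucc_lt_succ (i := i)).le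
  have e0 : ∀ {α : Type} (f : Fin (k + 1) → α) (y : α),
      (Fin.snoc f y : Fin (k + 2) → α) 0 = f 0 := fun f y => by
    rw [← Fin.castSucc_zero, Fin.snoc_castSucc]
  have h1 := hP (k + 1) (Fin.snoc τ u) hmono (by rw [e0]; exact h0) (Fin.snoc x j)
  have h2 := hP k τ hτ h0 x
  rw [Fin.prod_univ_castSucc] at h1
  simp only [e0, Fin.succ_castSucc, Fin.snoc_castSucc, Fin.succ_last, Fin.snoc_last,
    Nat.succ_eq_add_one] at h1
  rw [← mul_assoc, ← h2, mul_comm] at h1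
  rw [← h1]
  congr 1
  ext ω
  simp only [mem_inter_iff, mem_ofPred_eq, Fin.forall_fin_succ', Fin.snoc_castSucc, Fin.snoc_last]

theorem HasMarkovLaws.measureReal_cylinder (hP : HasMarkovLaws μ M P) {s h : ℝ} (hs : 0 ≤ s)
    (hh : 0 ≤ h) (I : Finset ℝ) (hI : ∀ u ∈ I, 0 ≤ u ∧ u ≤ s) (x : ℝ → Fin r) (k j : Fin r) :
    μ.real ({ω | ∀ u ∈ I, M u ω = x u} ∩ {ω | M s ω = k ∧ M (s + h) ω = j}) =
      P h k j * μ.real ({ω | ∀ u ∈ I, M u ω = x u} ∩ {ω | M s ω = k}) := by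
  -- If the cylinder already prescribes a value other than `k` at time `s`, both sides vanish.
  -- Otherwise `s` can be added to the times with value `k`; after sorting it comes last, because
  -- every time in `I` is at most `s`.
  by_cases hc : s ∈ I ∧ x s ≠ k
  · have e : ∀ A : Set Ω, A ⊆ {ω | M s ω = k} → {ω | ∀ u ∈ I, M u ω = x u} ∩ A = ∅ := by
      intro A hA
      ext ω
      simp only [mem_inter_iff, mem_ofPred_eq, mem_empty_iff_false, iff_false, not_and]
      intro h1 h2
      exact hc.2 ((h1 s hc.1).symm.trans (hA h2))
    rw [e _ (fun ω hω => hω.1), e _ subset_rfl]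
    simp
  · set J := insert s I with hJ
    have hcard : J.card = (J.card - 1) + 1 :=
      (Nat.succ_pred_eq_of_pos (Finset.card_pos.2 ⟨s, Finset.mem_insert_self s I⟩)).symm
    set m := J.card - 1
    set τ : Fin (m + 1) → ℝ := fun l => J.orderEmbOfFin hcard l with hτ
    have hJs : ∀ u ∈ J, 0 ≤ u ∧ u ≤ s := by
      intro u hu
      rcases Finset.mem_insert.1 hu with rfl | hu
      exacts [⟨hs, le_rfl⟩, hI u hu]
    have hτJ : ∀ l, τ l ∈ J := fun l => J.orderEmbOfFin_mem hcard l
    have hτm : Monotone τ := (J.orderEmbOfFin hcard).monotone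
    have hrange : ∀ u ∈ J, ∃ l, τ l = u := by
      intro u hu
      have := J.range_orderEmbOfFin hcard
      have hu' : u ∈ Set.range (J.orderEmbOfFin hcard) := by rw [this]; exact hu
      exact hu'
    have hlast : τ (Fin.last m) = s := by
      refine le_antisymm (hJs _ (hτJ _)).2 ?_
      obtain ⟨l, hl⟩ := hrange s (Finset.mem_insert_self s I)
      rw [← hl]
      exact hτm (Fin.le_last l)
    have key := hP.measureReal_snoc hτm (hJs _ (hτJ 0)).1
      (fun l => Function.update x s k (τ l)) (u := s + h) (by rw [hlast]; linarith) j
    rw [hlast] at key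
    simp only [add_sub_cancel_left, Function.update_self] at key
    have e : {ω | ∀ u ∈ I, M u ω = x u} ∩ {ω | M s ω = k} =
        {ω | ∀ l, M (τ l) ω = Function.update x s k (τ l)} := by
      ext ω
      simp only [mem_inter_iff, mem_ofPred_eq]
      constructor
      · rintro ⟨h1, h2⟩ l
        by_cases hl : τ l = s
        · rw [hl, Function.update_self, h2]
        · rw [Function.update_of_ne hl]
          exact h1 _ ((Finset.mem_insert.1 (hτJ l)).resolve_left hl)
      · intro h1
        have h2 : M s ω = k := by
          have := h1 (Fin.last m)
          rwa [hlast, Function.update_self] at this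
        refine ⟨fun u hu => ?_, h2⟩
        obtain ⟨l, rfl⟩ := hrange u (Finset.mem_insert_of_mem hu)
        by_cases hl : τ l = s
        · rw [hl] at hu ⊢
          rw [h2]
          by_contra hne
          exact hc ⟨hu, fun h => hne h.symm⟩
        · have := h1 l
          rwa [Function.update_of_ne hl] at this
    rw [e, ← key, ← e, inter_assoc]
    rfl

/-- The Markov property: the past before `s` enters the law of `M (s + h)` only through `M s`. -/
theorem IsMarkovChain.setIntegral_transition [IsFiniteMeasure μ] (hM : IsMarkovChain μ Q M)
    (hT : IsTransitionFunction Q P) (hP : HasMarkovLaws μ M P) {s h : ℝ} (hs : 0 ≤ s) (hh : 0 ≤ h)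
    {Y : Ω → ℝ} (hY : Measurable[pastSigma M s] Y) (k j : Fin r) :
    ∫ ω in {ω | M s ω = k ∧ M (s + h) ω = j}, Y ω ∂μ =
      P h k j * ∫ ω in {ω | M s ω = k}, Y ω ∂μ := by
  have hle := hM.pastSigma_le s
  have hp := hT.nonneg h hh k j
  -- Both sides are integrals of `Y` against finite measures on the past σ-algebra, so it suffices
  -- that these measures agree on cylinders and in total mass, the latter being the empty cylinder.
  have heq : (μ.restrict {ω | M s ω = k ∧ M (s + h) ω = j}).trim hle =
      ENNReal.ofReal (P h k j) • (μ.restrict {ω | M s ω = k}).trim hle := by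
    have hfin : ENNReal.ofReal (P h k j) ≠ ⊤ := ENNReal.ofReal_ne_top
    have hcyl : ∀ (I : Finset ℝ), (∀ u ∈ I, 0 ≤ u ∧ u ≤ s) → ∀ x : ℝ → Fin r,
        (μ.restrict {ω | M s ω = k ∧ M (s + h) ω = j}).trim hle {ω | ∀ u ∈ I, M u ω = x u} =
        (ENNReal.ofReal (P h k j) • (μ.restrict {ω | M s ω = k}).trim hle)
          {ω | ∀ u ∈ I, M u ω = x u} := by
      intro I hI x
      have hmeas : MeasurableSet[pastSigma M s] {ω | ∀ u ∈ I, M u ω = x u} := by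
        rw [pastSigma_eq_generateFrom]
        exact MeasurableSpace.measurableSet_generateFrom ⟨I, hI, x, rfl⟩
      have key := hP.measureReal_cylinder hs hh I hI x k j
      rw [Measure.smul_apply, trim_measurableSet_eq hle hmeas, trim_measurableSet_eq hle hmeas,
        Measure.restrict_apply (hle _ hmeas), Measure.restrict_apply (hle _ hmeas), smul_eq_mul,
        ← ofReal_measureReal, key, ENNReal.ofReal_mul hp, ofReal_measureReal]
    refine ext_of_generate_finite _ (pastSigma_eq_generateFrom M s) ?_ ?_ ?_
    · rintro _ ⟨I, hI, x, rfl⟩ _ ⟨J, hJ, y, rfl⟩ ⟨ω₀, h1, h2⟩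
      classical
      -- A nonempty intersection of two cylinders is again a cylinder: any point `ω₀` of it supplies
      -- the common prescribed values.
      refine ⟨I ∪ J, fun u hu => ?_, fun u => M u ω₀, ?_⟩
      · rcases Finset.mem_union.1 hu with hu | hu
        exacts [hI u hu, hJ u hu]
      · ext ω
        simp only [mem_inter_iff, mem_ofPred_eq, Finset.mem_union] at h1 h2 ⊢
        constructor
        · rintro ⟨h3, h4⟩ u (hu | hu)
          · rw [h3 u hu, h1 u hu]
          · rw [h4 u hu, h2 u hu]
        · intro h3
          exact ⟨fun u hu => by rw [h3 u (Or.inl hu), h1 u hu],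
            fun u hu => by rw [h3 u (Or.inr hu), h2 u hu]⟩
    · rintro _ ⟨I, hI, x, rfl⟩
      exact hcyl I hI x
    · have := hcyl ∅ (by simp) (fun _ => k)
      simpa using this
  have hsm : StronglyMeasurable[pastSigma M s] Y :=
    @Measurable.stronglyMeasurable _ _ _ (pastSigma M s) _ _ _ _ _ hY
  rw [integral_trim hle hsm, heq, integral_smul_measure, ← integral_trim hle hsm,
    ENNReal.toReal_ofReal hp, smul_eq_mul]

/-- Only off-diagonal intensities are given; the diagonal derivative follows because the rows of `P
h` sum to one. -/
theorem IsTransitionFunction.tendsto_sub_one_div (hT : IsTransitionFunction Q P)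
    (hQ : IsIntensityMatrix Q) (i j : Fin r) :
    Tendsto (fun h => (P h i j - (1 : Matrix (Fin r) (Fin r) ℝ) i j) / h) (𝓝[>] 0)
      (𝓝 (Q i j)) := by
  by_cases hij : i = j
  · subst hij
    rw [hQ.diag]
    have h1 := (tendsto_finsetSum (Finset.univ.erase i) fun j hj =>
      hT.intensity i j (Finset.ne_of_mem_erase hj).symm).neg
    refine h1.congr' ?_
    filter_upwards [self_mem_nhdsWithin] with h hh
    have h2 := hT.row_sum h (le_of_lt hh) i
    rw [← Finset.add_sum_erase _ _ (Finset.mem_univ i)] at h2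
    rw [← Finset.sum_div, ← neg_div, Matrix.one_apply_eq]
    congr 1
    linarith
  · simpa [Matrix.one_apply_ne hij] using hT.intensity i j hij

theorem IsTransitionFunction.tendsto_zero (hT : IsTransitionFunction Q P)
    (hQ : IsIntensityMatrix Q) (i j : Fin r) :
    Tendsto (fun h => P h i j - (1 : Matrix (Fin r) (Fin r) ℝ) i j) (𝓝[≥] 0) (𝓝 0) := by
  rw [← Ioi_insert, nhdsWithin_insert, tendsto_sup]
  constructor
  · rw [tendsto_pure_left]
    intro s hs
    rw [hT.zero, sub_self]
    exact mem_of_mem_nhds hs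
  · have h1 : Tendsto (fun h : ℝ => h) (𝓝[>] 0) (𝓝 0) := nhdsWithin_le_nhds
    have h2 := (hT.tendsto_sub_one_div hQ i j).mul h1
    rw [mul_zero] at h2
    refine h2.congr' ?_
    filter_upwards [self_mem_nhdsWithin] with h hh
    exact div_mul_cancel₀ _ (ne_of_gt hh)

end Markov

/-! ### The Feynman–Kac formula for the discounted chain. -/

theorem abs_exp_neg_sub_one_le {x : ℝ} (hx : 0 ≤ x) : |Real.exp (-x) - 1| ≤ x := by
  have h1 := Real.add_one_le_exp (-x)
  have h2 := Real.exp_le_one_iff.2 (neg_nonpos.2 hx)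
  rw [abs_le]
  constructor <;> linarith

theorem tendsto_zero_of_tendsto_div {l : ℝ → ℝ} {a : ℝ}
    (h : Tendsto (fun h => l h / h) (𝓝[>] 0) (𝓝 a)) : Tendsto l (𝓝[>] 0) (𝓝 0) := by
  have h1 : Tendsto (fun h : ℝ => h) (𝓝[>] 0) (𝓝 0) := nhdsWithin_le_nhds
  have h2 := h.mul h1
  rw [mul_zero] at h2
  refine h2.congr' ?_
  filter_upwards [self_mem_nhdsWithin] with x hx
  exact div_mul_cancel₀ _ (ne_of_gt hx)

/-- The difference quotient of `exp` at `0` extends continuously as `dslope`, so times with `l h =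
0` need no separate treatment. -/
theorem tendsto_exp_neg_sub_one_div {l : ℝ → ℝ} {a : ℝ}
    (h : Tendsto (fun h => l h / h) (𝓝[>] 0) (𝓝 a)) :
    Tendsto (fun h => (Real.exp (-l h) - 1) / h) (𝓝[>] 0) (𝓝 (-a)) := by
  have h0 := tendsto_zero_of_tendsto_div h
  have hd : Tendsto (fun x : ℝ => dslope Real.exp 0 x) (𝓝 0) (𝓝 1) := by
    have : ContinuousAt (dslope Real.exp 0) 0 :=
      continuousAt_dslope_same.2 Real.differentiable_exp.differentiableAt
    simpa [ContinuousAt] using this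
  have h1 : Tendsto (fun h => -l h) (𝓝[>] 0) (𝓝 0) := by simpa using h0.neg
  have h2 := (hd.comp h1).mul h.neg
  rw [one_mul] at h2
  refine h2.congr fun x => ?_
  have h3 := sub_smul_dslope Real.exp 0 (-l x)
  rw [sub_zero, Real.exp_zero, smul_eq_mul] at h3
  rw [← h3, Function.comp_apply]
  ring

/-- The weight `W` discounted at rate `lam (M u) * c` over `[t, t + s]`. -/
noncomputable def discounted {Ω : Type*} {r : ℕ} (M : ℝ → Ω → Fin r) (lam : Fin r → ℝ) (c t : ℝ)
    (W : Ω → ℝ) (s : ℝ) (ω : Ω) : ℝ :=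
  W ω * Real.exp (-cumIntensity lam (fun _ => c) M t (t + s) ω)

/-- The mean discounted weight on the event that the regime at time `t + s` is `k`. -/
noncomputable def discountedMean {Ω : Type*} [MeasurableSpace Ω] (μ : Measure Ω) {r : ℕ}
    (M : ℝ → Ω → Fin r) (lam : Fin r → ℝ) (c t : ℝ) (W : Ω → ℝ) (s : ℝ) (k : Fin r) : ℝ :=
  ∫ ω in {ω | M (t + s) ω = k}, discounted M lam c t W s ω ∂μ

theorem abs_discounted_le {Ω : Type*} {r : ℕ} {M : ℝ → Ω → Fin r} {lam : Fin r → ℝ}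
    {c t C s : ℝ} {W : Ω → ℝ} (hlam : ∀ i, 0 ≤ lam i) (hc : 0 ≤ c)
    (ht : 0 ≤ t) (hC : ∀ ω, |W ω| ≤ C) (hs : 0 ≤ s) (ω : Ω) :
    |discounted M lam c t W s ω| ≤ C := by
  have h1 := cumIntensity_nonneg (M := M) hlam (IsExposure.const hc) ht
    (show t ≤ t + s by linarith) ω
  rw [discounted, abs_mul, Real.abs_exp]
  calc |W ω| * _ ≤ |W ω| * 1 :=
        mul_le_mul_of_nonneg_left (Real.exp_le_one_iff.2 (by linarith)) (abs_nonneg _)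
    _ ≤ C := by rw [mul_one]; exact hC ω

section FeynmanKac

variable {Ω : Type*} [mΩ : MeasurableSpace Ω] {μ : Measure Ω} {r : ℕ}
  {Q : Matrix (Fin r) (Fin r) ℝ} {M : ℝ → Ω → Fin r} {P : ℝ → Matrix (Fin r) (Fin r) ℝ}

variable {lam : Fin r → ℝ} {c t C s h : ℝ} {W : Ω → ℝ}

theorem IsMarkovChain.measurable_discounted (hM : IsMarkovChain μ Q M) (hc : 0 ≤ c)
    (ht : 0 ≤ t) (hW : Measurable[pastSigma M t] W) (hs : 0 ≤ s) :
    Measurable[pastSigma M (t + s)] (discounted M lam c t W s) := by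
  have hts : t ≤ t + s := by linarith
  refine (hW.mono (pastSigma_mono hts) le_rfl).mul (Real.measurable_exp.comp ?_)
  exact (hM.measurable_cumIntensity lam (IsExposure.const hc) ht hts).neg

theorem IsMarkovChain.integrable_discounted [IsFiniteMeasure μ] (hM : IsMarkovChain μ Q M)
    (hlam : ∀ i, 0 ≤ lam i) (hc : 0 ≤ c) (ht : 0 ≤ t) (hW : Measurable[pastSigma M t] W)
    (hC : ∀ ω, |W ω| ≤ C) (hs : 0 ≤ s) : Integrable (discounted M lam c t W s) μ :=
  Integrable.of_bound (C := C)
    ((hM.measurable_discounted hc ht hW hs).mono (hM.pastSigma_le _) le_rfl).aestronglyMeasurable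
    (Eventually.of_forall fun ω => abs_discounted_le hlam hc ht hC hs ω)

theorem IsMarkovChain.discounted_add (hM : IsMarkovChain μ Q M)
    (hlam : ∀ i, 0 ≤ lam i) (hc : 0 ≤ c) (ht : 0 ≤ t) (hs : 0 ≤ s) (hh : 0 ≤ h) (ω : Ω) :
    discounted M lam c t W (s + h) ω = discounted M lam c t W s ω *
      Real.exp (-cumIntensity lam (fun _ => c) M (t + s) (t + s + h) ω) := by
  rw [discounted, discounted, mul_assoc, ← Real.exp_add, ← add_assoc,
    ← hM.cumIntensity_add hlam (IsExposure.const hc) ht (b := t + s) (by linarith) (by linarith)]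
  ring_nf

theorem IsMarkovChain.setIntegral_discounted_add [IsFiniteMeasure μ] (hM : IsMarkovChain μ Q M)
    (hT : IsTransitionFunction Q P) (hP : HasMarkovLaws μ M P)
    (hlam : ∀ i, 0 ≤ lam i) (hc : 0 ≤ c) (ht : 0 ≤ t) (hW : Measurable[pastSigma M t] W)
    (hC : ∀ ω, |W ω| ≤ C) (hs : 0 ≤ s) (hh : 0 ≤ h) (j : Fin r) :
    ∫ ω in {ω | M (t + s + h) ω = j}, discounted M lam c t W s ω ∂μ =
      ∑ k, discountedMean μ M lam c t W s k * P h k j := by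
  have hts : 0 ≤ t + s := by linarith
  have e : {ω | M (t + s + h) ω = j} =
      ⋃ k ∈ (Finset.univ : Finset (Fin r)), {ω | M (t + s) ω = k ∧ M (t + s + h) ω = j} := by
    ext ω; simp
  rw [e, integral_biUnion_finset]
  · refine Finset.sum_congr rfl fun k _ => ?_
    rw [hM.setIntegral_transition hT hP hts hh (hM.measurable_discounted hc ht hW hs) k j, mul_comm]
    rfl
  · intro k _
    exact (hM.measurableSet_eq hts k).inter (hM.measurableSet_eq (by linarith) j)
  · intro k _ l _ hkl
    refine Set.disjoint_left.2 fun ω h1 h2 => hkl ?_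
    exact h1.1.symm.trans h2.1
  · intro k _
    exact (hM.integrable_discounted hlam hc ht hW hC hs).integrableOn

/-- The increment splits into the motion of the regime with the discount frozen at `s`, evaluated by
the Markov property, and the extra discount over `[t + s, t + s + h]`. Divided by `h`, they produce
`Q` and `-cΛ` respectively. -/
theorem IsMarkovChain.discountedMean_add_sub [IsFiniteMeasure μ] (hM : IsMarkovChain μ Q M)
    (hT : IsTransitionFunction Q P) (hP : HasMarkovLaws μ M P)
    (hlam : ∀ i, 0 ≤ lam i) (hc : 0 ≤ c) (ht : 0 ≤ t) (hW : Measurable[pastSigma M t] W)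
    (hC : ∀ ω, |W ω| ≤ C) (hs : 0 ≤ s) (hh : 0 ≤ h) (j : Fin r) :
    discountedMean μ M lam c t W (s + h) j - discountedMean μ M lam c t W s j =
      ∑ k, discountedMean μ M lam c t W s k * (P h k j - (1 : Matrix (Fin r) (Fin r) ℝ) k j) +
      ∫ ω in {ω | M (t + s + h) ω = j}, discounted M lam c t W s ω *
        (Real.exp (-cumIntensity lam (fun _ => c) M (t + s) (t + s + h) ω) - 1) ∂μ := by
  have h1 : ∑ k, discountedMean μ M lam c t W s k * (1 : Matrix (Fin r) (Fin r) ℝ) k j =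
      discountedMean μ M lam c t W s j := by
    simp [Matrix.one_apply]
  simp_rw [mul_sub]
  rw [Finset.sum_sub_distrib, h1,
    ← hM.setIntegral_discounted_add hT hP hlam hc ht hW hC hs hh, integral_sub]
  · simp_rw [mul_one, ← hM.discounted_add hlam hc ht hs hh]
    rw [discountedMean, add_assoc]
    ring
  · refine Integrable.integrableOn ?_
    simp_rw [← hM.discounted_add hlam hc ht hs hh]
    exact hM.integrable_discounted hlam hc ht hW hC (by linarith)
  · simp_rw [mul_one]
    exact (hM.integrable_discounted hlam hc ht hW hC hs).integrableOn

theorem IsMarkovChain.tendsto_discountedMean_slope [IsProbabilityMeasure μ]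
    (hM : IsMarkovChain μ Q M) (hT : IsTransitionFunction Q P) (hP : HasMarkovLaws μ M P)
    (hlam : ∀ i, 0 ≤ lam i) (hc : 0 ≤ c) (ht : 0 ≤ t) (hW : Measurable[pastSigma M t] W)
    (hC : ∀ ω, |W ω| ≤ C) (hs : 0 ≤ s) (j : Fin r) :
    Tendsto (fun h => (discountedMean μ M lam c t W (s + h) j -
        discountedMean μ M lam c t W s j) / h) (𝓝[>] 0)
      (𝓝 (∑ k, discountedMean μ M lam c t W s k * (Q - c • Matrix.diagonal lam) k j)) := by
  have hts : 0 ≤ t + s := by linarith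
  have hγ := IsExposure.const hc
  have hint : ∀ k : Fin r, IntegrableOn (discounted M lam c t W s) {ω | M (t + s) ω = k} μ :=
    fun k => (hM.integrable_discounted hlam hc ht hW hC hs).integrableOn
  have hpos : ∀ᶠ h in 𝓝[>] (0 : ℝ), 0 < h := self_mem_nhdsWithin
  have hle1 : ∀ᶠ h in 𝓝[>] (0 : ℝ), h ≤ 1 :=
    nhdsWithin_le_nhds (Iic_mem_nhds one_pos)
  -- The horizon extends one unit beyond `t + s`, so a single `K` dominates the quotients for all `h
  -- ≤ 1`.
  obtain ⟨K, hK0, hK⟩ := hM.exists_cumIntensity_le hlam hγ (t + s + 1)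
  have hdis : Tendsto (fun h => ∫ ω in {ω | M (t + s + h) ω = j}, discounted M lam c t W s ω *
      ((Real.exp (-cumIntensity lam (fun _ => c) M (t + s) (t + s + h) ω) - 1) / h) ∂μ) (𝓝[>] 0)
      (𝓝 (∫ ω in {ω | M (t + s) ω = j}, discounted M lam c t W s ω *
        (-(lam (M (t + s) ω) * c)) ∂μ)) := by
    refine hM.tendsto_setIntegral_regime hts j (C := C * K) ?_ ?_ fun ω => ?_
    · filter_upwards [hpos] with h hh
      refine ((hM.measurable_discounted hc ht hW hs).mono (hM.pastSigma_le _) le_rfl).mul ?_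
      refine ((Real.measurable_exp.comp ?_).sub_const 1).div_const h
      exact ((hM.measurable_cumIntensity lam hγ hts (by linarith)).mono
        (hM.pastSigma_le _) le_rfl).neg
    · filter_upwards [hpos, hle1] with h hh h1 ω
      rw [abs_mul]
      refine mul_le_mul (abs_discounted_le hlam hc ht hC hs ω) ?_ (abs_nonneg _)
        ((abs_nonneg _).trans (hC ω))
      rw [abs_div, abs_of_pos hh, div_le_iff₀ hh]
      refine (abs_exp_neg_sub_one_le (cumIntensity_nonneg hlam hγ hts (by linarith) ω)).trans ?_
      have := hK (t + s) (t + s + h) ω hts (by linarith) (by linarith)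
      simpa using this
    · exact (tendsto_exp_neg_sub_one_div (hM.tendsto_cumIntensity_div hlam hγ hts
        continuousWithinAt_const ω)).const_mul _
  have hlim : ∫ ω in {ω | M (t + s) ω = j}, discounted M lam c t W s ω *
        (-(lam (M (t + s) ω) * c)) ∂μ = -(c * lam j) * discountedMean μ M lam c t W s j := by
    rw [discountedMean, ← integral_const_mul]
    refine setIntegral_congr_fun (hM.measurableSet_eq hts j) fun ω hω => ?_
    have : M (t + s) ω = j := hω
    simp only [this]
    ring
  rw [hlim] at hdis
  have hsum := tendsto_finsetSum (Finset.univ : Finset (Fin r)) fun k _ =>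
    (hT.tendsto_sub_one_div hM.intensityMatrix k j).const_mul (discountedMean μ M lam c t W s k)
  have htot := hsum.add hdis
  have hval : ∑ k, discountedMean μ M lam c t W s k * Q k j +
      -(c * lam j) * discountedMean μ M lam c t W s j =
      ∑ k, discountedMean μ M lam c t W s k * (Q - c • Matrix.diagonal lam) k j := by
    simp only [Matrix.sub_apply, Matrix.smul_apply, smul_eq_mul, mul_sub, Finset.sum_sub_distrib,
      Matrix.diagonal_apply]
    simp
    ring
  rw [hval] at htot
  refine htot.congr' ?_
  filter_upwards [hpos] with h hh
  rw [hM.discountedMean_add_sub hT hP hlam hc ht hW hC hs hh.le, add_div, Finset.sum_div,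
    ← integral_div]
  congr 1
  · exact Finset.sum_congr rfl fun k _ => by rw [mul_div_assoc]
  · simp_rw [mul_div_assoc]

theorem IsMarkovChain.abs_discountedMean_le [IsProbabilityMeasure μ]
    (hlam : ∀ i, 0 ≤ lam i) (hc : 0 ≤ c) (ht : 0 ≤ t)
    (hC : ∀ ω, |W ω| ≤ C) (hs : 0 ≤ s) (k : Fin r) :
    |discountedMean μ M lam c t W s k| ≤ C := by
  obtain ⟨ω⟩ := μ.nonempty_of_neZero
  have hC0 : 0 ≤ C := (abs_nonneg _).trans (hC ω)
  refine (norm_setIntegral_le_of_norm_le_const (f := discounted M lam c t W s)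
    (measure_lt_top μ _) fun ω _ => abs_discounted_le hlam hc ht hC hs ω).trans ?_
  exact mul_le_of_le_one_right hC0 measureReal_le_one

/-- Right derivatives do not control the limit from the left. The increment from `a` to `b` is
bounded by a modulus `ε (b - a)` independent of the base point, which gives continuity from both
sides. -/
theorem IsMarkovChain.continuousOn_discountedMean [IsProbabilityMeasure μ]
    (hM : IsMarkovChain μ Q M) (hT : IsTransitionFunction Q P) (hP : HasMarkovLaws μ M P)
    (hlam : ∀ i, 0 ≤ lam i) (hc : 0 ≤ c) (ht : 0 ≤ t) (hW : Measurable[pastSigma M t] W)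
    (hC : ∀ ω, |W ω| ≤ C) (S : ℝ) (j : Fin r) :
    ContinuousOn (fun s => discountedMean μ M lam c t W s j) (Icc 0 S) := by
  have hγ := IsExposure.const hc
  obtain ⟨ω⟩ := μ.nonempty_of_neZero
  have hC0 : 0 ≤ C := (abs_nonneg _).trans (hC ω)
  obtain ⟨K, hK0, hK⟩ := hM.exists_cumIntensity_le hlam hγ (t + S)
  set ε : ℝ → ℝ := fun h => ∑ k, C * |P h k j - (1 : Matrix (Fin r) (Fin r) ℝ) k j| + C * (K * h)
    with hε
  have hεlim : Tendsto ε (𝓝[≥] 0) (𝓝 0) := by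
    have h1 : Tendsto (fun h : ℝ => h) (𝓝[≥] 0) (𝓝 0) := nhdsWithin_le_nhds
    have h2 := (tendsto_finsetSum (Finset.univ : Finset (Fin r)) fun k _ =>
      (hT.tendsto_zero hM.intensityMatrix k j).abs.const_mul C).add ((h1.const_mul K).const_mul C)
    simpa using h2
  have key : ∀ a b, 0 ≤ a → a ≤ b → b ≤ S → |discountedMean μ M lam c t W b j -
      discountedMean μ M lam c t W a j| ≤ ε (b - a) := by
    intro a b ha hab hb
    have h1 := hM.discountedMean_add_sub hT hP hlam hc ht hW hC ha (sub_nonneg.2 hab) j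
    rw [add_sub_cancel] at h1
    rw [h1, hε]
    refine (abs_add_le _ _).trans (add_le_add ((Finset.abs_sum_le_sum_abs _ _).trans
      (Finset.sum_le_sum fun k _ => ?_)) ?_)
    · rw [abs_mul]
      exact mul_le_mul_of_nonneg_right (abs_discountedMean_le hlam hc ht hC ha k) (abs_nonneg _)
    · have h0 : 0 ≤ b - a := sub_nonneg.2 hab
      have h2 : ∀ ω, ‖discounted M lam c t W a ω *
          (Real.exp (-cumIntensity lam (fun _ => c) M (t + a) (t + a + (b - a)) ω) - 1)‖ ≤
          C * (K * (b - a)) := by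
        intro ω
        rw [norm_mul]
        refine mul_le_mul (abs_discounted_le hlam hc ht hC ha ω) ?_ (norm_nonneg _) hC0
        refine (abs_exp_neg_sub_one_le
          (cumIntensity_nonneg hlam hγ (by linarith) (by linarith) ω)).trans ?_
        have := hK (t + a) (t + a + (b - a)) ω (by linarith) (by linarith) (by linarith)
        simpa using this
      refine (norm_setIntegral_le_of_norm_le_const (measure_lt_top μ _) fun ω _ => h2 ω).trans
        (mul_le_of_le_one_right (by positivity) measureReal_le_one)
  intro s hs
  rw [ContinuousWithinAt, tendsto_iff_dist_tendsto_zero]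
  have h1 : Tendsto (fun u => |u - s|) (𝓝[Icc 0 S] s) (𝓝[≥] 0) := by
    refine tendsto_nhdsWithin_iff.2 ⟨?_, Eventually.of_forall fun u => mem_Ici.2 (abs_nonneg _)⟩
    have : Continuous fun u : ℝ => |u - s| := by fun_prop
    simpa using (this.tendsto s).mono_left nhdsWithin_le_nhds
  refine squeeze_zero' (Eventually.of_forall fun u => dist_nonneg) ?_ (hεlim.comp h1)
  filter_upwards [self_mem_nhdsWithin] with u hu
  rw [Real.dist_eq, Function.comp_apply]
  rcases le_total s u with h | h
  · rw [abs_of_nonneg (sub_nonneg.2 h)]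
    exact key s u hs.1 h hu.2
  · rw [abs_sub_comm u s, abs_of_nonneg (sub_nonneg.2 h), abs_sub_comm]
    exact key u s hu.1 h hs.2

theorem hasDerivAt_matrix_exp_smul {r : ℕ} (B : Matrix (Fin r) (Fin r) ℝ) (x : ℝ) (k j : Fin r) :
    HasDerivAt (fun s : ℝ => NormedSpace.exp (s • B) k j)
      ((B * NormedSpace.exp (x • B)) k j) x := by
  -- An auxiliary norm serves only to differentiate the exponential; the entrywise conclusion does
  -- not depend on it.
  let _ : NormedRing (Matrix (Fin r) (Fin r) ℝ) := Matrix.linftyOpNormedRing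
  let _ : NormedAlgebra ℝ (Matrix (Fin r) (Fin r) ℝ) := Matrix.linftyOpNormedAlgebra
  have h := hasDerivAt_exp_smul_const' (𝕂 := ℝ) B x
  have h2 : HasDerivAt (fun s : ℝ => fun k => NormedSpace.exp (s • B) k)
    (fun k => (B * NormedSpace.exp (x • B)) k) x := h
  exact hasDerivAt_pi.1 (hasDerivAt_pi.1 h2 k) j

/-- The Feynman–Kac formula for the chain discounted at rate `c * lam`. -/
theorem IsMarkovChain.discountedMean_eq [IsProbabilityMeasure μ]
    (hM : IsMarkovChain μ Q M)
    (hlam : ∀ i, 0 ≤ lam i) (hc : 0 ≤ c) (ht : 0 ≤ t) (hW : Measurable[pastSigma M t] W)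
    (hC : ∀ ω, |W ω| ≤ C) (hs : 0 ≤ s) (j : Fin r) :
    discountedMean μ M lam c t W s j = ∑ k, (∫ ω in {ω | M t ω = k}, W ω ∂μ) *
      NormedSpace.exp (s • (Q - c • Matrix.diagonal lam)) k j := by
  obtain ⟨P, hT, hP⟩ := hM.markov
  set B := Q - c • Matrix.diagonal lam with hB
  set v := discountedMean μ M lam c t W with hv
  have hv0 : ∀ k, v 0 k = ∫ ω in {ω | M t ω = k}, W ω ∂μ := fun k => by
    simp [hv, discountedMean, discounted, cumIntensity]
  have hexp : ∀ (k : Fin r) (u : ℝ), HasDerivAt (fun u => NormedSpace.exp ((s - u) • B) k j)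
      (-(B * NormedSpace.exp ((s - u) • B)) k j) u := fun k u => by
    exact (hasDerivAt_matrix_exp_smul B (s - u) k j).comp_const_sub s u
  have hderiv : ∀ u ∈ Ico 0 s, ∀ k, HasDerivWithinAt (fun u => v u k) (∑ l, v u l * B l k)
      (Ici u) u := by
    intro u hu k
    refine ((hasDerivWithinAt_iff_tendsto_slope' (s := Ioi u) (lt_irrefl u)).2 ?_).Ici_of_Ioi
    have h1 := hM.tendsto_discountedMean_slope hT hP hlam hc ht hW hC hu.1 k
    have h3 : Tendsto (fun x : ℝ => x - u) (𝓝[>] u) (𝓝[>] 0) := by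
      refine tendsto_nhdsWithin_iff.2 ⟨?_, ?_⟩
      · have : Continuous fun x : ℝ => x - u := by fun_prop
        simpa using (this.tendsto u).mono_left nhdsWithin_le_nhds
      · filter_upwards [self_mem_nhdsWithin] with x hx
        exact sub_pos.2 (mem_Ioi.1 hx)
    refine (h1.comp h3).congr fun x => ?_
    simp [slope_def_field, hv]
  -- The function `u ↦ v u * exp ((s - u) B)` has right derivative `v B exp - v B exp = 0`; its
  -- values at `s` and at `0` are the two sides of the formula.
  have hconst := constant_of_has_deriv_right_zero (a := 0) (b := s)
    (f := fun u => ∑ k, v u k * NormedSpace.exp ((s - u) • B) k j) ?_ ?_ s ⟨hs, le_rfl⟩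
  · simp only [sub_self, zero_smul, NormedSpace.exp_zero, sub_zero, hv0] at hconst
    rw [← hconst]
    simp [Matrix.one_apply]
  · refine continuousOn_finsetSum _ fun k _ => ContinuousOn.mul
      (hM.continuousOn_discountedMean hT hP hlam hc ht hW hC s k) fun u _ => ?_
    exact (hexp k u).continuousAt.continuousWithinAt
  · intro u hu
    have h1 := HasDerivWithinAt.fun_sum (u := Finset.univ) fun k _ =>
      (hderiv u hu k).mul (hexp k u).hasDerivWithinAt
    refine h1.congr_deriv ?_
    set E := NormedSpace.exp ((s - u) • B)
    simp only [mul_neg, Finset.sum_add_distrib, Finset.sum_neg_distrib, Matrix.mul_apply,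
      Finset.sum_mul, Finset.mul_sum]
    rw [Finset.sum_comm, add_neg_eq_zero]
    refine Finset.sum_congr rfl fun k _ => Finset.sum_congr rfl fun l _ => ?_
    ring

end FeynmanKac

/-! ### Event counts given the path of the chain. -/

/-- The Poisson probability of the value `n` for the mean `x`. -/
noncomputable def poissonMass (n : ℕ) (x : ℝ) : ℝ := Real.exp (-x) * x ^ n / (n.factorial : ℝ)

theorem poissonMass_nonneg (n : ℕ) {x : ℝ} (hx : 0 ≤ x) : 0 ≤ poissonMass n x := by
  unfold poissonMass; positivity

theorem poissonMass_le_one (n : ℕ) {x : ℝ} (hx : 0 ≤ x) : poissonMass n x ≤ 1 := by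
  rw [poissonMass, mul_div_assoc]
  calc Real.exp (-x) * (x ^ n / (n.factorial : ℝ)) ≤ Real.exp (-x) * Real.exp x :=
        mul_le_mul_of_nonneg_left (Real.pow_div_factorial_le_exp x hx n) (Real.exp_pos _).le
    _ = 1 := by rw [← Real.exp_add]; simp

theorem measurable_poissonMass (n : ℕ) : Measurable (poissonMass n) := by
  unfold poissonMass; fun_prop

theorem poissonMass_zero (x : ℝ) : poissonMass 0 x = Real.exp (-x) := by simp [poissonMass]

theorem poissonMass_one (x : ℝ) : poissonMass 1 x = Real.exp (-x) * x := by simp [poissonMass]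

/-- Agreement on the half-open interval suffices because the end-point is null; the exposure may
jump at the end of the window. -/
theorem cumIntensity_congr {Ω : Type*} {r : ℕ} {M : ℝ → Ω → Fin r} {lam : Fin r → ℝ}
    {γ γ' : ℝ → ℝ} {a b : ℝ} (hab : a ≤ b) (h : ∀ u ∈ Ico a b, γ u = γ' u) :
    cumIntensity lam γ M a b = cumIntensity lam γ' M a b := by
  funext ω
  rw [cumIntensity, cumIntensity, intervalIntegral.integral_of_le hab,
    intervalIntegral.integral_of_le hab, ← integral_Ico_eq_integral_Ioc,
    ← integral_Ico_eq_integral_Ioc]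
  exact setIntegral_congr_fun measurableSet_Ico fun u hu => by simp only [h u hu]

/-- The conditional probability of `{M t = i, N t = n}` given the path of `M`. -/
noncomputable def stateWeight {Ω : Type*} {r : ℕ} (M : ℝ → Ω → Fin r) (lam : Fin r → ℝ)
    (γ : ℝ → ℝ) (t : ℝ) (i : Fin r) (n : ℕ) : Ω → ℝ :=
  {ω | M t ω = i}.indicator fun ω => poissonMass n (cumIntensity lam γ M 0 t ω)

namespace IsMMNPP

variable {Ω : Type*} [mΩ : MeasurableSpace Ω] {μ : Measure Ω} {r : ℕ}
  {Q : Matrix (Fin r) (Fin r) ℝ} {lam : Fin r → ℝ} {γ : ℝ → ℝ} {M : ℝ → Ω → Fin r}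
  {N : ℝ → Ω → ℕ}

/-- This is the defining property of conditional expectation, applied on an event `S` of the path
σ-algebra. -/
theorem measureReal_inter_increments [IsFiniteMeasure μ] (h : IsMMNPP μ Q lam γ M N) {S : Set Ω}
    (hS : MeasurableSet[pathSigma M] S) {k : ℕ} {s : Fin (k + 1) → ℝ} (hs : Monotone s)
    (h0 : 0 ≤ s 0) (z : Fin k → ℕ) :
    μ.real (S ∩ {ω | ∀ l : Fin k, N (s l.succ) ω = N (s l.castSucc) ω + z l}) =
      ∫ ω in S, ∏ l : Fin k,
        poissonMass (z l) (cumIntensity lam γ M (s l.castSucc) (s l.succ) ω) ∂μ := by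
  have hle := h.chain.pathSigma_le
  have hs0 : ∀ l, 0 ≤ s l := fun l => h0.trans (hs (Fin.zero_le l))
  have hE : MeasurableSet {ω | ∀ l : Fin k, N (s l.succ) ω = N (s l.castSucc) ω + z l} := by
    have : {ω | ∀ l : Fin k, N (s l.succ) ω = N (s l.castSucc) ω + z l} =
      ⋂ l : Fin k, {ω | N (s l.succ) ω = N (s l.castSucc) ω + z l} := by ext; simp
    rw [this]
    exact MeasurableSet.iInter fun l => measurableSet_eq_fun (h.measurable _ (hs0 _))
      ((h.measurable _ (hs0 _)).add_const _)
  have h1 := setIntegral_condExp hle (μ := μ)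
    (f := ({ω | ∀ l : Fin k, N (s l.succ) ω = N (s l.castSucc) ω + z l}).indicator
      (fun _ => (1 : ℝ))) ((integrable_const 1).indicator hE) hS
  rw [setIntegral_indicator hE] at h1
  simp only [integral_const, smul_eq_mul, mul_one, measureReal_restrict_apply_univ] at h1
  rw [← h1]
  exact setIntegral_congr_ae (hle _ hS) ((h.poisson k s hs h0 z).mono fun ω hω _ => hω)

theorem measureReal_constant [IsProbabilityMeasure μ] (h : IsMMNPP μ Q lam γ M N) {a b : ℝ}
    (ha : 0 ≤ a) (hab : a ≤ b) :
    μ.real {ω | N b ω = N a ω} = ∫ ω, Real.exp (-cumIntensity lam γ M a b ω) ∂μ := by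
  have h1 := h.measureReal_inter_increments (S := univ) MeasurableSet.univ (k := 1)
    (s := ![a, b]) (by
      rw [Fin.monotone_iff_le_succ]; intro i; fin_cases i; simpa using hab) (by simpa using ha)
    ![0]
  simpa [poissonMass_zero] using h1

theorem measureReal_inter_counts [IsFiniteMeasure μ] (h : IsMMNPP μ Q lam γ M N) {S : Set Ω}
    (hS : MeasurableSet[pathSigma M] S) {t s u : ℝ} (ht : 0 ≤ t) (hts : t ≤ s) (hsu : s ≤ u)
    (n m : ℕ) :
    μ.real (S ∩ {ω | N t ω = n ∧ N s ω = n ∧ N u ω = n + m}) =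
      ∫ ω in S, poissonMass n (cumIntensity lam γ M 0 t ω) *
        Real.exp (-cumIntensity lam γ M t s ω) * poissonMass m (cumIntensity lam γ M s u ω) ∂μ := by
  -- Since `N` starts at `0`, the prescribed counts amount to increments `n`, `0`, `m` over `0 ≤ t ≤
  -- s ≤ u`.
  have h1 := h.measureReal_inter_increments hS (k := 3)
    (s := ![0, t, s, u]) (by
      rw [Fin.monotone_iff_le_succ]; intro i; fin_cases i <;> simpa) (by simp) ![n, 0, m]
  have e : {ω | N t ω = n ∧ N s ω = n ∧ N u ω = n + m} =
      {ω | ∀ l : Fin 3, N ((![0, t, s, u] : Fin 4 → ℝ) l.succ) ω =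
        N ((![0, t, s, u] : Fin 4 → ℝ) l.castSucc) ω + (![n, 0, m] : Fin 3 → ℕ) l} := by
    ext ω
    simp [Fin.forall_fin_succ, h.start]
    omega
  rw [e, h1]
  refine integral_congr_ae (Eventually.of_forall fun ω => ?_)
  simp [Fin.prod_univ_succ, poissonMass_zero, mul_assoc]

/-- By monotonicity, failure forces `N u ≠ N T` for every `u < T`. That event has probability `1 - E
exp (-∫ λγ) ≤ K (T - u)`, which tends to `0` as `u ↑ T`. -/
theorem ae_eventually_eq_left [IsProbabilityMeasure μ] (h : IsMMNPP μ Q lam γ M N)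
    (hγ : IsExposure γ) {T : ℝ} (hT : 0 < T) :
    ∀ᵐ ω ∂μ, ∀ᶠ u in 𝓝[<] T, N u ω = N T ω := by
  obtain ⟨K, hK0, hK⟩ := h.chain.exists_cumIntensity_le h.lam_nonneg hγ T
  have hmeas : ∀ u, 0 ≤ u → MeasurableSet {ω | N T ω = N u ω} := fun u hu =>
    measurableSet_eq_fun (h.measurable T hT.le) (h.measurable u hu)
  have hbound : ∀ u, 0 ≤ u → u < T →
      μ {ω | ¬ ∀ᶠ u in 𝓝[<] T, N u ω = N T ω} ≤ ENNReal.ofReal (K * (T - u)) := by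
    intro u hu huT
    calc μ {ω | ¬ ∀ᶠ u in 𝓝[<] T, N u ω = N T ω} ≤ μ {ω | N T ω = N u ω}ᶜ := by
          refine measure_mono fun ω hω hu' => hω ?_
          filter_upwards [Ioo_mem_nhdsLT huT] with v hv
          have h1 := h.mono ω u v hu hv.1.le
          have h2 := h.mono ω v T (hu.trans hv.1.le) hv.2.le
          have h3 : N T ω = N u ω := hu'
          omega
      _ = ENNReal.ofReal (1 - μ.real {ω | N T ω = N u ω}) := by
          rw [← probReal_compl_eq_one_sub (hmeas u hu), ofReal_measureReal]
      _ ≤ ENNReal.ofReal (K * (T - u)) := by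
          refine ENNReal.ofReal_le_ofReal ?_
          rw [h.measureReal_constant hu huT.le]
          have hint : Integrable (fun ω => Real.exp (-cumIntensity lam γ M u T ω)) μ := by
            refine Integrable.of_bound (C := 1) (Real.measurable_exp.comp
              ((h.chain.measurable_cumIntensity lam hγ hu huT.le).mono
                (h.chain.pastSigma_le _) le_rfl).neg).aestronglyMeasurable
              (Eventually.of_forall fun ω => ?_)
            rw [Real.norm_of_nonneg (Real.exp_pos _).le]
            exact Real.exp_le_one_iff.2
              (neg_nonpos.2 (cumIntensity_nonneg h.lam_nonneg hγ hu huT.le ω))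
          have h1 : ∫ _, (1 - K * (T - u)) ∂μ ≤
              ∫ ω, Real.exp (-cumIntensity lam γ M u T ω) ∂μ :=
            integral_mono (integrable_const _) hint fun ω => by
              have h2 := hK u T ω hu huT.le le_rfl
              have h3 := Real.add_one_le_exp (-cumIntensity lam γ M u T ω)
              show 1 - K * (T - u) ≤ Real.exp (-cumIntensity lam γ M u T ω)
              linarith
          rw [integral_const, probReal_univ, one_smul] at h1
          linarith
  have hlim : Tendsto (fun u => ENNReal.ofReal (K * (T - u))) (𝓝[<] T) (𝓝 0) := by
    have : Continuous fun u => ENNReal.ofReal (K * (T - u)) :=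
      ENNReal.continuous_ofReal.comp (by fun_prop)
    simpa using (this.tendsto T).mono_left nhdsWithin_le_nhds
  refine le_antisymm (ge_of_tendsto hlim ?_) zero_le
  filter_upwards [Ioo_mem_nhdsLT hT] with u hu using hbound u hu.1.le hu.2

theorem leftCountEvent_ae_eq [IsProbabilityMeasure μ] (h : IsMMNPP μ Q lam γ M N)
    (hγ : IsExposure γ) {T : ℝ} (hT : 0 < T) (n : ℕ) :
    leftCountEvent N T n =ᵐ[μ] {ω | N T ω = n} := by
  filter_upwards [h.ae_eventually_eq_left hγ hT] with ω hω
  refine propext ⟨fun h1 => ?_, fun h1 => ?_⟩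
  · have h1' : ∀ᶠ u in 𝓝[<] T, N u ω = n := h1
    obtain ⟨u, hu1, hu2⟩ := (hω.and h1').exists
    exact hu1.symm.trans hu2
  · have h1' : N T ω = n := h1
    exact hω.mono fun u hu => hu.trans h1'

theorem measurable_stateWeight (h : IsMMNPP μ Q lam γ M N) (hγ : IsExposure γ) {t : ℝ}
    (ht : 0 ≤ t) (i : Fin r) (n : ℕ) : Measurable[pastSigma M t] (stateWeight M lam γ t i n) :=
  Measurable.indicator
    ((measurable_poissonMass n).comp (h.chain.measurable_cumIntensity lam hγ le_rfl ht))
    (measurableSet_pastSigma ht le_rfl i)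

theorem abs_stateWeight_le (h : IsMMNPP μ Q lam γ M N) (hγ : IsExposure γ) {t : ℝ}
    (ht : 0 ≤ t) (i : Fin r) (n : ℕ) (ω : Ω) : |stateWeight M lam γ t i n ω| ≤ 1 := by
  have h0 := cumIntensity_nonneg (M := M) h.lam_nonneg hγ le_rfl ht ω
  refine (norm_indicator_le_norm_self
    (fun ω => poissonMass n (cumIntensity lam γ M 0 t ω)) ω).trans ?_
  rw [Real.norm_of_nonneg (poissonMass_nonneg n h0)]
  exact poissonMass_le_one n h0

/-- The probability that no event arrives in `(t, t + s]` and `m` events arrive in `(t + s, u]`. -/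
theorem measureReal_state_inter [IsFiniteMeasure μ] (h : IsMMNPP μ Q lam γ M N)
    {t s u c : ℝ} (ht : 0 ≤ t) (hs : 0 ≤ s) (hu : t + s ≤ u)
    (hγc : ∀ u ∈ Ico t (t + s), γ u = c) (i j : Fin r) (n m : ℕ) :
    μ.real (stateEvent M N t i n ∩ {ω | N (t + s) ω = n ∧ N u ω = n + m ∧ M u ω = j}) =
      ∫ ω in {ω | M u ω = j}, discounted M lam c t (stateWeight M lam γ t i n) s ω *
        poissonMass m (cumIntensity lam γ M (t + s) u ω) ∂μ := by
  have hu0 : 0 ≤ u := by linarith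
  have hSi := pastSigma_le_pathSigma (M := M) t _ (measurableSet_pastSigma ht le_rfl i)
  have hSj := pastSigma_le_pathSigma (M := M) u _ (measurableSet_pastSigma hu0 le_rfl j)
  have e : stateEvent M N t i n ∩ {ω | N (t + s) ω = n ∧ N u ω = n + m ∧ M u ω = j} =
      ({ω | M u ω = j} ∩ {ω | M t ω = i}) ∩
        {ω | N t ω = n ∧ N (t + s) ω = n ∧ N u ω = n + m} := by
    ext ω
    simp only [stateEvent, mem_inter_iff, mem_ofPred_eq]
    tauto
  rw [e, h.measureReal_inter_counts (hSj.inter hSi) ht (by linarith) hu,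
    ← setIntegral_indicator (h.chain.pathSigma_le _ hSi)]
  refine integral_congr_ae (Eventually.of_forall fun ω => ?_)
  simp only [discounted, stateWeight, indicator, cumIntensity_congr (by linarith) hγc]
  split_ifs <;> simp

theorem measureReal_state_survival [IsFiniteMeasure μ] (h : IsMMNPP μ Q lam γ M N)
    {t s c : ℝ} (ht : 0 ≤ t) (hs : 0 ≤ s)
    (hγc : ∀ u ∈ Ico t (t + s), γ u = c) (i j : Fin r) (n : ℕ) :
    μ.real (stateEvent M N t i n ∩ stateEvent M N (t + s) j n) =
      discountedMean μ M lam c t (stateWeight M lam γ t i n) s j := by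
  have h1 := h.measureReal_state_inter ht hs le_rfl hγc i j n 0
  have e : stateEvent M N (t + s) j n =
      {ω | N (t + s) ω = n ∧ N (t + s) ω = n + 0 ∧ M (t + s) ω = j} := by
    ext ω; simp only [stateEvent, mem_ofPred_eq]; omega
  rw [e, h1, discountedMean]
  simp [poissonMass_zero, cumIntensity]

/-- The weight vanishes off `{M t = i}`, so only row `i` of the exponential contributes in the
Feynman–Kac formula. -/
theorem discountedMean_stateWeight [IsProbabilityMeasure μ] (h : IsMMNPP μ Q lam γ M N)
    (hγ : IsExposure γ) {t s c : ℝ} (ht : 0 ≤ t) (hs : 0 ≤ s) (hc : 0 ≤ c)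
    (i j : Fin r) (n : ℕ) :
    discountedMean μ M lam c t (stateWeight M lam γ t i n) s j =
      μ.real (stateEvent M N t i n) *
        NormedSpace.exp (s • (Q - c • Matrix.diagonal lam)) i j := by
  rw [h.chain.discountedMean_eq h.lam_nonneg hc ht (h.measurable_stateWeight hγ ht i n)
    (h.abs_stateWeight_le hγ ht i n) hs, Finset.sum_eq_single i]
  -- Survival over an empty window identifies the total weight; the constancy condition is then
  -- vacuous and `c = 0` is arbitrary.
  · have h1 := h.measureReal_state_survival (s := 0) (c := 0) ht le_rfl (by simp) i i n
    rw [add_zero, inter_self] at h1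
    rw [h1]
    simp [discountedMean, discounted, cumIntensity]
  · intro k _ hki
    have : ∫ ω in {ω | M t ω = k}, stateWeight M lam γ t i n ω ∂μ =
        ∫ ω in {ω | M t ω = k}, (0 : ℝ) ∂μ := by
      refine setIntegral_congr_fun (h.chain.measurableSet_eq ht k) fun ω hω => ?_
      have : M t ω = k := hω
      simp [stateWeight, this, hki]
    rw [this]; simp
  · simp

/-- Given the path, one event in the last window has probability `exp (-ℓ) * ℓ` with `ℓ ≤ K x`, and
`ℓ / x` tends to `λ_{M(t+s)} γ (t + s)`. Dominated convergence applies, and the regime at the end of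
the window may be replaced by the one at `t + s`. -/
theorem tendsto_measureReal_arrival_div [IsProbabilityMeasure μ] (h : IsMMNPP μ Q lam γ M N)
    (hγ : IsExposure γ) {t s c : ℝ} (ht : 0 ≤ t) (hs : 0 ≤ s) (hc : 0 ≤ c)
    (hγc : ∀ u ∈ Ico t (t + s), γ u = c)
    (hend : ContinuousWithinAt γ (Ici (t + s)) (t + s)) (i j : Fin r) (n : ℕ) :
    Tendsto (fun x => μ.real (stateEvent M N t i n ∩
        {ω | N (t + s) ω = n ∧ N (t + s + x) ω = n + 1 ∧ M (t + s + x) ω = j}) / x) (𝓝[>] 0)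
      (𝓝 (discountedMean μ M lam c t (stateWeight M lam γ t i n) s j *
        (γ (t + s) * lam j))) := by
  have hts : 0 ≤ t + s := by linarith
  have hpos : ∀ᶠ x in 𝓝[>] (0 : ℝ), 0 < x := self_mem_nhdsWithin
  have hle1 : ∀ᶠ x in 𝓝[>] (0 : ℝ), x ≤ 1 := nhdsWithin_le_nhds (Iic_mem_nhds one_pos)
  obtain ⟨K, hK0, hK⟩ := h.chain.exists_cumIntensity_le h.lam_nonneg hγ (t + s + 1)
  have hWm := h.measurable_stateWeight hγ ht i n
  have hWb := h.abs_stateWeight_le hγ ht i n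
  have key : Tendsto (fun x => ∫ ω in {ω | M (t + s + x) ω = j},
      discounted M lam c t (stateWeight M lam γ t i n) s ω *
        (poissonMass 1 (cumIntensity lam γ M (t + s) (t + s + x) ω) / x) ∂μ) (𝓝[>] 0)
      (𝓝 (∫ ω in {ω | M (t + s) ω = j},
        discounted M lam c t (stateWeight M lam γ t i n) s ω *
          (lam (M (t + s) ω) * γ (t + s)) ∂μ)) := by
    refine h.chain.tendsto_setIntegral_regime hts j (C := 1 * K) ?_ ?_ fun ω => ?_
    · filter_upwards [hpos] with x hx
      refine ((h.chain.measurable_discounted hc ht hWm hs).mono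
        (h.chain.pastSigma_le _) le_rfl).mul (((measurable_poissonMass 1).comp ?_).div_const x)
      exact (h.chain.measurable_cumIntensity lam hγ hts (by linarith)).mono
        (h.chain.pastSigma_le _) le_rfl
    · filter_upwards [hpos, hle1] with x hx h1 ω
      rw [abs_mul]
      refine mul_le_mul (abs_discounted_le h.lam_nonneg hc ht hWb hs ω) ?_ (abs_nonneg _)
        zero_le_one
      have h0 := cumIntensity_nonneg (M := M) h.lam_nonneg hγ hts
        (show t + s ≤ t + s + x by linarith) ω
      rw [abs_div, abs_of_pos hx, div_le_iff₀ hx, abs_of_nonneg (poissonMass_nonneg 1 h0),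
        poissonMass_one]
      have h2 := hK (t + s) (t + s + x) ω hts (by linarith) (by linarith)
      rw [add_sub_cancel_left] at h2
      exact (mul_le_of_le_one_left h0 (Real.exp_le_one_iff.2 (by linarith))).trans h2
    · have h1 := h.chain.tendsto_cumIntensity_div h.lam_nonneg hγ hts hend ω
      have h2 := (Real.continuous_exp.tendsto _).comp (tendsto_zero_of_tendsto_div h1).neg
      have h3 := h2.mul h1
      rw [neg_zero, Real.exp_zero, one_mul] at h3
      refine (h3.congr fun x => ?_).const_mul _
      rw [poissonMass_one, mul_div_assoc]
      rfl
  have hval : ∫ ω in {ω | M (t + s) ω = j},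
        discounted M lam c t (stateWeight M lam γ t i n) s ω *
          (lam (M (t + s) ω) * γ (t + s)) ∂μ =
      discountedMean μ M lam c t (stateWeight M lam γ t i n) s j * (γ (t + s) * lam j) := by
    rw [discountedMean, ← integral_mul_const]
    refine setIntegral_congr_fun (h.chain.measurableSet_eq hts j) fun ω hω => ?_
    have : M (t + s) ω = j := hω
    simp only [this]
    ring
  rw [hval] at key
  refine key.congr' ?_
  filter_upwards [hpos] with x hx
  rw [h.measureReal_state_inter ht hs (by linarith) hγc i j n 1, ← integral_div]
  simp_rw [mul_div_assoc]

end IsMMNPP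

/-! ### Pointwise limits for the conditional probabilities. -/

theorem mmnppDensity_apply {r : ℕ} (Q : Matrix (Fin r) (Fin r) ℝ) (lam : Fin r → ℝ) (c g s : ℝ)
    (i j : Fin r) : mmnppDensity Q lam c g s i j =
      NormedSpace.exp (s • (Q - c • Matrix.diagonal lam)) i j * (g * lam j) := by
  rw [mmnppDensity, Matrix.mul_smul, Matrix.smul_apply, Matrix.mul_diagonal, smul_eq_mul]
  ring

theorem measureReal_cond {Ω : Type*} [MeasurableSpace Ω] {μ : Measure Ω} {s : Set Ω}
    (hs : MeasurableSet s) (t : Set Ω) :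
    (ProbabilityTheory.cond μ s).real t = (μ.real s)⁻¹ * μ.real (s ∩ t) := by
  simp [measureReal_def, ProbabilityTheory.cond_apply hs]

theorem cond_congr_ae {Ω : Type*} [MeasurableSpace Ω] {μ : Measure Ω} {s t : Set Ω}
    (h : s =ᵐ[μ] t) : ProbabilityTheory.cond μ s = ProbabilityTheory.cond μ t := by
  rw [ProbabilityTheory.cond, ProbabilityTheory.cond, measure_congr h, Measure.restrict_congr_set h]

namespace IsMMNPP

variable {Ω : Type*} [mΩ : MeasurableSpace Ω] {μ : Measure Ω} {r : ℕ}
  {Q : Matrix (Fin r) (Fin r) ℝ} {lam : Fin r → ℝ} {γ : ℝ → ℝ} {M : ℝ → Ω → Fin r}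
  {N : ℝ → Ω → ℕ}

theorem measurableSet_stateEvent (h : IsMMNPP μ Q lam γ M N) {t : ℝ} (ht : 0 ≤ t) (i : Fin r)
    (n : ℕ) : MeasurableSet (stateEvent M N t i n) :=
  (h.chain.measurableSet_eq ht i).inter (h.measurable t ht (measurableSet_singleton n))

variable [IsProbabilityMeasure μ] {t tstar c : ℝ} {i j : Fin r} {n : ℕ}

theorem cond_survival (h : IsMMNPP μ Q lam γ M N) (hγ : IsExposure γ) (ht : 0 ≤ t)
    (hs : 0 ≤ tstar) (hc : 0 ≤ c) (hγc : ∀ u ∈ Ico t (t + tstar), γ u = c)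
    (hpos : μ (stateEvent M N t i n) ≠ 0) :
    (ProbabilityTheory.cond μ (stateEvent M N t i n)).real (stateEvent M N (t + tstar) j n) =
      NormedSpace.exp (tstar • (Q - c • Matrix.diagonal lam)) i j := by
  have hp : μ.real (stateEvent M N t i n) ≠ 0 := (measureReal_ne_zero_iff).2 hpos
  rw [measureReal_cond (h.measurableSet_stateEvent ht i n),
    h.measureReal_state_survival ht hs hγc, h.discountedMean_stateWeight hγ ht hs hc,
    inv_mul_cancel_left₀ hp]

theorem tendsto_cond_arrival (h : IsMMNPP μ Q lam γ M N) (hγ : IsExposure γ) (ht : 0 ≤ t)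
    (hs : 0 < tstar) (hc : 0 ≤ c) (hγc : ∀ u ∈ Ico t (t + tstar), γ u = c)
    (hend : ContinuousWithinAt γ (Ici (t + tstar)) (t + tstar))
    (hpos : μ (stateEvent M N t i n) ≠ 0) :
    Tendsto (fun h : ℝ =>
        (ProbabilityTheory.cond μ (stateEvent M N t i n)).real
          (leftCountEvent N (t + tstar) n ∩ stateEvent M N (t + tstar + h) j (n + 1)) / h)
      (𝓝[>] 0) (𝓝 (mmnppDensity Q lam c (γ (t + tstar)) tstar i j)) := by
  have hp : μ.real (stateEvent M N t i n) ≠ 0 := (measureReal_ne_zero_iff).2 hpos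
  have h1 := (h.tendsto_measureReal_arrival_div hγ ht hs.le hc hγc hend i j n).const_mul
    (μ.real (stateEvent M N t i n))⁻¹
  rw [h.discountedMean_stateWeight hγ ht hs.le hc, ← mul_assoc, inv_mul_cancel_left₀ hp,
    ← mmnppDensity_apply] at h1
  refine h1.congr fun x => ?_
  rw [measureReal_cond (h.measurableSet_stateEvent ht i n), mul_div_assoc]
  congr 2
  refine measureReal_congr ?_
  filter_upwards [h.leftCountEvent_ae_eq hγ (T := t + tstar) (by linarith) n] with ω hω
  have hω' : ω ∈ leftCountEvent N (t + tstar) n ↔ N (t + tstar) ω = n := iff_of_eq hω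
  refine propext ?_
  change (ω ∈ stateEvent M N t i n ∧ (N (t + tstar) ω = n ∧ N (t + tstar + x) ω = n + 1 ∧
    M (t + tstar + x) ω = j)) ↔ (ω ∈ stateEvent M N t i n ∧ (ω ∈ leftCountEvent N (t + tstar) n ∧
    (M (t + tstar + x) ω = j ∧ N (t + tstar + x) ω = n + 1)))
  rw [hω']
  tauto

theorem tendsto_cond_survival_mul_arrival (h : IsMMNPP μ Q lam γ M N) (hγ : IsExposure γ)
    (ht : 0 ≤ t) (hs : 0 < tstar) (hc : 0 ≤ c) (hγc : ∀ u ∈ Ico t (t + tstar), γ u = c)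
    (hend : ContinuousWithinAt γ (Ici (t + tstar)) (t + tstar))
    (hpos : μ (stateEvent M N t i n) ≠ 0) :
    Tendsto (fun h : ℝ =>
        (ProbabilityTheory.cond μ (stateEvent M N t i n)).real
          ({ω | M (t + tstar) ω = j} ∩ leftCountEvent N (t + tstar) n) *
        ((ProbabilityTheory.cond μ
            ({ω | M (t + tstar) ω = j} ∩ leftCountEvent N (t + tstar) n)).real
          (stateEvent M N (t + tstar + h) j (n + 1)) / h))
      (𝓝[>] 0) (𝓝 (mmnppDensity Q lam c (γ (t + tstar)) tstar i j)) := by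
  have hT : 0 < t + tstar := by linarith
  have hae : ({ω | M (t + tstar) ω = j} ∩ leftCountEvent N (t + tstar) n : Set Ω) =ᵐ[μ]
      stateEvent M N (t + tstar) j n :=
    (ae_eq_refl _).inter (h.leftCountEvent_ae_eq hγ hT n)
  have hsurv := h.cond_survival (j := j) hγ ht hs.le hc hγc hpos
  rw [cond_congr_ae hae,
    measureReal_congr (ProbabilityTheory.cond_absolutelyContinuous.ae_eq hae), hsurv,
    mmnppDensity_apply]
  -- If the intermediate state is null, the survival probability, hence the entry of the
  -- exponential, is zero, and both sides vanish whatever the second factor.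
  by_cases hD : μ.real (stateEvent M N (t + tstar) j n) = 0
  · have h0 : NormedSpace.exp (tstar • (Q - c • Matrix.diagonal lam)) i j = 0 := by
      rw [← hsurv, measureReal_cond (h.measurableSet_stateEvent ht i n),
        measureReal_mono_null inter_subset_right hD, mul_zero]
    simp only [h0, zero_mul]
    exact tendsto_const_nhds
  refine Tendsto.const_mul _ ?_
  have hend' : ContinuousWithinAt γ (Ici (t + tstar + 0)) (t + tstar + 0) := by simpa using hend
  -- The arrival limit is restarted from state `(j, n)` at time `t + tstar` with a window of length
  -- zero: its exponential is the identity and only the rate `γ (t + tstar) * lam j` remains.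
  have h1 := (h.tendsto_measureReal_arrival_div hγ hT.le le_rfl le_rfl
    (by simp) hend' j j n).const_mul (μ.real (stateEvent M N (t + tstar) j n))⁻¹
  rw [h.discountedMean_stateWeight hγ hT.le le_rfl le_rfl, ← mul_assoc, inv_mul_cancel_left₀ hD]
    at h1
  simp only [zero_smul, NormedSpace.exp_zero, Matrix.one_apply_eq, one_mul, add_zero] at h1
  refine h1.congr fun x => ?_
  rw [measureReal_cond (h.measurableSet_stateEvent hT.le j n), mul_div_assoc]
  congr 3
  ext ω
  simp only [stateEvent, mem_inter_iff, mem_ofPred_eq]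
  tauto

end IsMMNPP

/-! ### Detecting the next arrival on a grid. -/

theorem le_gridPoint_natCast {a b : ℝ} (hab : a ≤ b) (k l : ℕ) : a ≤ gridPoint a b k l := by
  simpa using gridPoint_mono (k := k) hab (l.cast_nonneg (α := ℝ))

theorem gridPoint_natCast_add_one_le {a b : ℝ} (hab : a ≤ b) {k l : ℕ}
    (hl : l ∈ Finset.range (k + 1)) : gridPoint a b k ((l : ℝ) + 1) ≤ b := by
  have : (l : ℝ) + 1 ≤ (k : ℝ) + 1 := by exact_mod_cast Finset.mem_range.1 hl
  simpa using gridPoint_mono (k := k) hab this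

/-- Let `T` be the first time at which `f` differs from `f 0`. Only the cell containing `T` can
witness the left side, and on a fine grid `f` and `g` at its right end still have their values at
`T`. A jump of size two or more at `T` is thus rejected on both sides. -/
theorem eventually_exists_grid_iff {α : Type*} {f : ℝ → ℕ} {g : ℝ → α} {a b : ℝ} (ha : 0 ≤ a)
    (hab : a < b) (hf : ∀ u v, 0 ≤ u → u ≤ v → f u ≤ f v)
    (hfr : ∀ u, 0 ≤ u → ∀ᶠ v in 𝓝[≥] u, f v = f u)
    (hgr : ∀ u, 0 ≤ u → ∀ᶠ v in 𝓝[≥] u, g v = g u) (j : α) :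
    ∀ᶠ k in atTop, (∃ l ∈ Finset.range (k + 1), f (gridPoint a b k l) = f 0 ∧
        f (gridPoint a b k ((l : ℝ) + 1)) = f 0 + 1 ∧ g (gridPoint a b k ((l : ℝ) + 1)) = j) ↔
      ∃ s ∈ Ioc a b, (∀ u ∈ Ico 0 s, f u = f 0) ∧ f s = f 0 + 1 ∧ g s = j := by
  have hgrid0 : ∀ k l : ℕ, a ≤ gridPoint a b k l := le_gridPoint_natCast hab.le
  have hgrid1 : ∀ k l : ℕ, l ∈ Finset.range (k + 1) → gridPoint a b k ((l : ℝ) + 1) ≤ b :=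
    fun k l hl => gridPoint_natCast_add_one_le hab.le hl
  have hgrid2 : ∀ k l : ℕ, gridPoint a b k l ≤ gridPoint a b k ((l : ℝ) + 1) := fun k l =>
    gridPoint_mono hab.le (by linarith)
  have hf0 : ∀ u, 0 ≤ u → f 0 ≤ f u := fun u hu => hf 0 u le_rfl hu
  by_cases hb : f b = f 0
  · refine Eventually.of_forall fun k => iff_of_false ?_ ?_
    · rintro ⟨l, hl, -, h2, -⟩
      have := hf _ b (ha.trans ((hgrid0 k l).trans (hgrid2 k l))) (hgrid1 k l hl)
      omega
    · rintro ⟨s, hs, -, h2, -⟩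
      have := hf s b (ha.trans hs.1.le) hs.2
      omega
  by_cases hfa : f a = f 0
  swap
  · refine Eventually.of_forall fun k => iff_of_false ?_ ?_
    · rintro ⟨l, hl, h1, -, -⟩
      have h3 := hf a _ ha (hgrid0 k l)
      have h4 := hf0 a ha
      omega
    · rintro ⟨s, hs, h1, -, -⟩
      exact hfa (h1 a ⟨ha, hs.1⟩)
  set A : Set ℝ := {u | a ≤ u ∧ f u ≠ f 0} with hA
  have hbA : b ∈ A := ⟨hab.le, hb⟩
  have hbdd : BddBelow A := ⟨a, fun u hu => hu.1⟩
  set T := sInf A with hT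
  have haT : a ≤ T := le_csInf ⟨b, hbA⟩ fun u hu => hu.1
  have hTb : T ≤ b := csInf_le hbdd hbA
  have hT0 : 0 ≤ T := ha.trans haT
  have hbefore : ∀ u, 0 ≤ u → u < T → f u = f 0 := by
    intro u hu huT
    rcases le_total a u with h | h
    · by_contra hne
      exact notMem_of_lt_csInf huT hbdd ⟨h, hne⟩
    · have h1 := hf u a hu h
      have h2 := hf0 u hu
      omega
  -- Right continuity makes the infimum attained: otherwise `f` would stay at `f 0` slightly beyond
  -- `T`.
  have hTne : f T ≠ f 0 := by
    intro hTe
    obtain ⟨δ, hδ, hδ'⟩ := (mem_nhdsGE_iff_exists_Ico_subset).1 (hfr T hT0)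
    obtain ⟨u, hu, huδ⟩ := exists_lt_of_csInf_lt ⟨b, hbA⟩ (mem_Ioi.1 hδ)
    have h1 : f u = f T := hδ' ⟨csInf_le hbdd hu, huδ⟩
    exact hu.2 (h1.trans hTe)
  have haT' : a < T := lt_of_le_of_ne haT fun h => hTne (h ▸ hfa)
  have hTmem : T ∈ Ioc a b := ⟨haT', hTb⟩
  have hTgt : f 0 < f T := lt_of_le_of_ne (hf0 T hT0) (Ne.symm hTne)
  filter_upwards [(tendsto_gridCeil hab T).eventually (hfr T hT0),
    (tendsto_gridCeil hab T).eventually (hgr T hT0)] with k hk1 hk2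
  constructor
  · rintro ⟨l, hl, h1, h2, h3⟩
    have h4 : gridPoint a b k l < T := by
      by_contra hcon
      have := hf T _ hT0 (not_lt.1 hcon)
      omega
    have h5 : T ≤ gridPoint a b k ((l : ℝ) + 1) := by
      by_contra hcon
      have := hbefore _ (ha.trans ((hgrid0 k l).trans (hgrid2 k l))) (not_le.1 hcon)
      omega
    rw [gridCeil_eq hab ⟨h4, h5⟩] at hk1 hk2
    exact ⟨T, hTmem, fun u hu => hbefore u hu.1 hu.2, hk1 ▸ h2, hk2 ▸ h3⟩
  · rintro ⟨s, hs, h1, h2, h3⟩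
    have hsT : s = T := by
      rcases lt_trichotomy s T with h | h | h
      · have := hbefore s (ha.trans hs.1.le) h
        omega
      · exact h
      · exact absurd (h1 T ⟨hT0, h⟩) hTne
    subst hsT
    obtain ⟨l, hl, hl'⟩ := exists_mem_Ioc_gridPoint hab k hTmem
    rw [gridCeil_eq hab hl'] at hk1 hk2
    exact ⟨l, hl, hbefore _ (ha.trans (hgrid0 k l)) hl'.1, hk1.trans h2, hk2.trans h3⟩

/-- The event that exactly one event arrives in some cell of the uniform subdivision of
`(t + a, t + b]`, none arrives before that cell, and the regime is `j` at its end. -/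
def gridArrivalEvent {Ω : Type*} {r : ℕ} (M : ℝ → Ω → Fin r) (N : ℝ → Ω → ℕ)
    (t a b : ℝ) (n : ℕ) (j : Fin r) (k : ℕ) : Set Ω :=
  ⋃ l ∈ Finset.range (k + 1), {ω | N (t + gridPoint a b k l) ω = n ∧
    N (t + gridPoint a b k ((l : ℝ) + 1)) ω = n + 1 ∧
    M (t + gridPoint a b k ((l : ℝ) + 1)) ω = j}

theorem nhdsGE_map_const_add (t u : ℝ) : Tendsto (fun v => t + v) (𝓝[≥] u) (𝓝[≥] (t + u)) := by
  refine tendsto_nhdsWithin_iff.2 ⟨?_, ?_⟩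
  · have : Continuous fun v : ℝ => t + v := by fun_prop
    exact (this.tendsto u).mono_left nhdsWithin_le_nhds
  · filter_upwards [self_mem_nhdsWithin] with v hv
    exact mem_Ici.2 (add_le_add_right (mem_Ici.1 hv) t)

namespace IsMMNPP

variable {Ω : Type*} [mΩ : MeasurableSpace Ω] {μ : Measure Ω} {r : ℕ}
  {Q : Matrix (Fin r) (Fin r) ℝ} {lam : Fin r → ℝ} {γ : ℝ → ℝ} {M : ℝ → Ω → Fin r}
  {N : ℝ → Ω → ℕ}

theorem eventually_nhdsGE (h : IsMMNPP μ Q lam γ M N) (ω : Ω) {t : ℝ} (ht : 0 ≤ t) :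
    ∀ᶠ u in 𝓝[≥] t, N u ω = N t ω := by
  rw [← Ioi_insert, nhdsWithin_insert, eventually_sup]
  exact ⟨rfl, h.rightCont ω t ht⟩

theorem eventually_mem_gridArrivalEvent_iff (h : IsMMNPP μ Q lam γ M N) {t a b : ℝ} (ht : 0 ≤ t)
    (ha : 0 ≤ a) (hab : a < b) (i j : Fin r) (n : ℕ) (ω : Ω) :
    ∀ᶠ k in atTop, ω ∈ stateEvent M N t i n ∩ gridArrivalEvent M N t a b n j k ↔
      ω ∈ stateEvent M N t i n ∩ nextArrivalEvent M N t (Ioc a b) j := by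
  by_cases hω : ω ∈ stateEvent M N t i n
  swap
  · exact Eventually.of_forall fun k => iff_of_false (fun h1 => hω h1.1) (fun h1 => hω h1.1)
  have hn : N t ω = n := hω.2
  have key := eventually_exists_grid_iff (f := fun u => N (t + u) ω) (g := fun u => M (t + u) ω)
    ha hab (fun u v hu huv => h.mono ω _ _ (by linarith) (by linarith))
    (fun u hu => (nhdsGE_map_const_add t u).eventually
      (h.eventually_nhdsGE ω (by linarith : 0 ≤ t + u)))
    (fun u hu => (nhdsGE_map_const_add t u).eventually
      (h.chain.eventually_nhdsGE ω (by linarith : 0 ≤ t + u))) j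
  filter_upwards [key] with k hk
  simp only [add_zero, hn] at hk
  have e1 : ω ∈ gridArrivalEvent M N t a b n j k ↔ ∃ l ∈ Finset.range (k + 1),
      N (t + gridPoint a b k l) ω = n ∧ N (t + gridPoint a b k ((l : ℝ) + 1)) ω = n + 1 ∧
        M (t + gridPoint a b k ((l : ℝ) + 1)) ω = j := by
    simp only [gridArrivalEvent, mem_iUnion, exists_prop, mem_ofPred_eq]
  have e2 : ω ∈ nextArrivalEvent M N t (Ioc a b) j ↔ ∃ s ∈ Ioc a b,
      (∀ u ∈ Ico 0 s, N (t + u) ω = n) ∧ N (t + s) ω = n + 1 ∧ M (t + s) ω = j := by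
    simp only [nextArrivalEvent, mem_ofPred_eq, hn]
    refine exists_congr fun s => and_congr_right fun _ => and_congr_left fun _ => ?_
    constructor
    · intro h1 u hu
      exact h1 _ ⟨by linarith [hu.1], by linarith [hu.2]⟩
    · intro h1 u hu
      have := h1 (u - t) ⟨by linarith [hu.1], by linarith [hu.2]⟩
      rwa [add_sub_cancel] at this
  rw [mem_inter_iff, mem_inter_iff, e1, e2, hk]

theorem measurableSet_gridCell (h : IsMMNPP μ Q lam γ M N) {u v : ℝ} (hu : 0 ≤ u) (hv : 0 ≤ v)
    (j : Fin r) (n : ℕ) : MeasurableSet {ω | N u ω = n ∧ N v ω = n + 1 ∧ M v ω = j} :=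
  (h.measurable _ hu (measurableSet_singleton n)).inter
    ((h.measurable _ hv (measurableSet_singleton (n + 1))).inter (h.chain.measurableSet_eq hv j))

theorem measurableSet_gridArrivalEvent (h : IsMMNPP μ Q lam γ M N) {t a b : ℝ} (ht : 0 ≤ t)
    (ha : 0 ≤ a) (hab : a ≤ b) (j : Fin r) (n k : ℕ) :
    MeasurableSet (gridArrivalEvent M N t a b n j k) := by
  refine Finset.measurableSet_biUnion _ fun l _ => ?_
  have h1 := le_gridPoint_natCast hab k l
  have h2 := le_gridPoint_natCast hab k (l + 1)
  push_cast at h2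
  exact h.measurableSet_gridCell (by linarith) (by linarith) j n

/-- The event is an uncountable union over arrival times; it is measurable as a pointwise limit of
grid events. -/
theorem measurableSet_nextArrivalEvent_Ioc (h : IsMMNPP μ Q lam γ M N) {t a b : ℝ} (ht : 0 ≤ t)
    (ha : 0 ≤ a) (i j : Fin r) (n : ℕ) :
    MeasurableSet (stateEvent M N t i n ∩ nextArrivalEvent M N t (Ioc a b) j) := by
  rcases le_or_gt b a with hba | hab
  · simp [nextArrivalEvent, Ioc_eq_empty_of_le hba]
  · exact measurableSet_of_tendsto_indicator atTop
      (fun k => (h.measurableSet_stateEvent ht i n).inter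
        (h.measurableSet_gridArrivalEvent ht ha hab.le j n k))
      (h.eventually_mem_gridArrivalEvent_iff ht ha hab i j n)

theorem tendsto_measureReal_gridArrivalEvent [IsProbabilityMeasure μ]
    (h : IsMMNPP μ Q lam γ M N) {t a b : ℝ} (ht : 0 ≤ t)
    (ha : 0 ≤ a) (hab : a < b) (i j : Fin r) (n : ℕ) :
    Tendsto (fun k => μ.real (stateEvent M N t i n ∩ gridArrivalEvent M N t a b n j k)) atTop
      (𝓝 (μ.real (stateEvent M N t i n ∩ nextArrivalEvent M N t (Ioc a b) j))) := by
  refine (ENNReal.tendsto_toReal (measure_ne_top _ _)).comp ?_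
  exact tendsto_measure_of_tendsto_indicator_of_isFiniteMeasure atTop μ
    (fun k => (h.measurableSet_stateEvent ht i n).inter
        (h.measurableSet_gridArrivalEvent ht ha hab.le j n k))
    (h.eventually_mem_gridArrivalEvent_iff ht ha hab i j n)

end IsMMNPP

/-! ### The law of the next arrival on intervals. -/

theorem IsMarkovChain.tendsto_discounted {Ω : Type*} [MeasurableSpace Ω] {μ : Measure Ω} {r : ℕ}
    {Q : Matrix (Fin r) (Fin r) ℝ} {M : ℝ → Ω → Fin r} {lam : Fin r → ℝ} {c t u : ℝ} {W : Ω → ℝ}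
    (hM : IsMarkovChain μ Q M) (hlam : ∀ i, 0 ≤ lam i) (hc : 0 ≤ c) (ht : 0 ≤ t) (hu : 0 ≤ u)
    (ω : Ω) :
    Tendsto (fun v => discounted M lam c t W v ω) (𝓝[≥] u) (𝓝 (discounted M lam c t W u ω)) := by
  have hγ := IsExposure.const hc
  obtain ⟨K, hK0, hK⟩ := hM.exists_cumIntensity_le hlam hγ (t + u + 1)
  refine (Tendsto.rexp (Tendsto.neg ?_)).const_mul _
  have hlim : Tendsto (fun v => cumIntensity lam (fun _ => c) M t (t + u) ω + K * (v - u))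
      (𝓝[≥] u) (𝓝 (cumIntensity lam (fun _ => c) M t (t + u) ω)) := by
    have : Continuous fun v => cumIntensity lam (fun _ => c) M t (t + u) ω + K * (v - u) := by
      fun_prop
    simpa using (this.tendsto u).mono_left nhdsWithin_le_nhds
  have hev : ∀ᶠ v in 𝓝[≥] u, v ∈ Icc u (u + 1) := Icc_mem_nhdsGE (by linarith)
  refine tendsto_of_tendsto_of_tendsto_of_le_of_le' tendsto_const_nhds hlim ?_ ?_
  · filter_upwards [hev] with v hv
    rw [← hM.cumIntensity_add hlam hγ ht (b := t + u) (by linarith)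
      (by linarith [hv.1] : t + u ≤ t + v)]
    linarith [cumIntensity_nonneg (M := M) hlam hγ (by linarith : 0 ≤ t + u)
      (by linarith [hv.1] : t + u ≤ t + v) ω]
  · filter_upwards [hev] with v hv
    rw [← hM.cumIntensity_add hlam hγ ht (b := t + u) (by linarith)
      (by linarith [hv.1] : t + u ≤ t + v)]
    have := hK (t + u) (t + v) ω (by linarith) (by linarith [hv.1]) (by linarith [hv.2])
    have e : t + v - (t + u) = v - u := by ring
    rw [e] at this
    linarith

theorem IsMarkovChain.tendsto_indicator_discounted {Ω : Type*} [MeasurableSpace Ω]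
    {μ : Measure Ω} {r : ℕ} {Q : Matrix (Fin r) (Fin r) ℝ} {M : ℝ → Ω → Fin r} {lam : Fin r → ℝ}
    {c t u : ℝ} {W : Ω → ℝ} (h : IsMarkovChain μ Q M) (hlam : ∀ i, 0 ≤ lam i)
    (hc : 0 ≤ c) (ht : 0 ≤ t) (hu : 0 ≤ u) (j : Fin r) (ω : Ω) :
    Tendsto (fun v => {ω | M (t + v) ω = j}.indicator (discounted M lam c t W v) ω) (𝓝[≥] u)
      (𝓝 ({ω | M (t + u) ω = j}.indicator (discounted M lam c t W u) ω)) := by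
  have h1 := (nhdsGE_map_const_add t u).eventually
    (h.eventually_nhdsGE ω (by linarith : 0 ≤ t + u))
  by_cases hj : M (t + u) ω = j
  · rw [indicator_of_mem (by exact hj)]
    refine (h.tendsto_discounted hlam hc ht hu ω).congr' ?_
    filter_upwards [h1] with v hv
    rw [indicator_of_mem (by exact hv.trans hj)]
  · rw [indicator_of_notMem (by exact hj)]
    refine tendsto_const_nhds.congr' ?_
    filter_upwards [h1] with v hv
    rw [indicator_of_notMem]
    simpa [hv] using hj

namespace IsMMNPP

variable {Ω : Type*} [mΩ : MeasurableSpace Ω] {μ : Measure Ω} {r : ℕ}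
  {Q : Matrix (Fin r) (Fin r) ℝ} {lam : Fin r → ℝ} {γ : ℝ → ℝ} {M : ℝ → Ω → Fin r}
  {N : ℝ → Ω → ℕ}

/-- Given the path, a cell contributes the survival factor to its left end times `exp (-ℓ) * ℓ`,
where `ℓ` is its cumulative intensity. The factor `exp (-ℓ)` carries survival to the right end,
leaving exactly a term of a right end-point Riemann–Stieltjes sum. -/
theorem measureReal_gridArrivalEvent [IsProbabilityMeasure μ] (h : IsMMNPP μ Q lam γ M N)
    {t a b c : ℝ} (ht : 0 ≤ t) (ha : 0 ≤ a) (hab : a ≤ b) (hc : 0 ≤ c)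
    (hγ : IsExposure γ) (hγc : ∀ u ∈ Ico t (t + b), γ u = c) (i j : Fin r) (n k : ℕ) :
    μ.real (stateEvent M N t i n ∩ gridArrivalEvent M N t a b n j k) =
      ∫ ω, ∑ l ∈ Finset.range (k + 1),
        {ω | M (t + gridPoint a b k ((l : ℝ) + 1)) ω = j}.indicator
          (discounted M lam c t (stateWeight M lam γ t i n) (gridPoint a b k ((l : ℝ) + 1))) ω *
        (∫ u in (gridPoint a b k l)..(gridPoint a b k ((l : ℝ) + 1)), lam (M (t + u) ω) * c) ∂μ := by
  have hWm := h.measurable_stateWeight hγ ht i n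
  have hWb := h.abs_stateWeight_le hγ ht i n
  have hγ' := IsExposure.const hc
  have hg0 : ∀ l : ℕ, 0 ≤ gridPoint a b k l := fun l => ha.trans (le_gridPoint_natCast hab k l)
  have hg1 : ∀ l : ℕ, gridPoint a b k l ≤ gridPoint a b k ((l : ℝ) + 1) := fun l =>
    gridPoint_mono hab (by linarith)
  have hg2 : ∀ l : ℕ, 0 ≤ gridPoint a b k ((l : ℝ) + 1) := fun l => (hg0 l).trans (hg1 l)
  have hinner : ∀ (l : ℕ) (ω : Ω),
      ∫ u in (gridPoint a b k l)..(gridPoint a b k ((l : ℝ) + 1)), lam (M (t + u) ω) * c =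
      cumIntensity lam (fun _ => c) M (t + gridPoint a b k l)
        (t + gridPoint a b k ((l : ℝ) + 1)) ω := fun l ω =>
    intervalIntegral.integral_comp_add_left (fun u => lam (M u ω) * c) t
  simp_rw [hinner]
  rw [gridArrivalEvent, inter_iUnion₂, measureReal_biUnion_finset, integral_finsetSum]
  · refine Finset.sum_congr rfl fun l hl => ?_
    have hb := gridPoint_natCast_add_one_le hab hl
    rw [h.measureReal_state_inter ht (hg0 l) (by linarith [hg1 l])
      (fun u hu => hγc u ⟨hu.1, by linarith [hu.2, hg1 l]⟩) i j n 1,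
      ← integral_indicator (h.chain.measurableSet_eq (by linarith [hg2 l]) j)]
    refine integral_congr_ae (Eventually.of_forall fun ω => ?_)
    simp only [indicator]
    split_ifs with hj
    · have e : cumIntensity lam γ M (t + gridPoint a b k l)
          (t + gridPoint a b k ((l : ℝ) + 1)) = cumIntensity lam (fun _ => c) M
          (t + gridPoint a b k l) (t + gridPoint a b k ((l : ℝ) + 1)) :=
        cumIntensity_congr (by linarith [hg1 l]) fun u hu =>
          hγc u ⟨by linarith [hu.1, hg0 l], by linarith [hu.2]⟩
      have h1 := h.chain.discounted_add h.lam_nonneg hc ht (hg0 l) (sub_nonneg.2 (hg1 l)) ω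
        (W := stateWeight M lam γ t i n)
      have e2 : t + gridPoint a b k l + (gridPoint a b k ((l : ℝ) + 1) - gridPoint a b k l) =
        t + gridPoint a b k ((l : ℝ) + 1) := by ring
      rw [add_sub_cancel, e2] at h1
      rw [e, poissonMass_one, h1, mul_assoc]
    · simp
  · intro l hl
    refine Integrable.bdd_mul (c := 1) ?_
      (((h.chain.measurable_discounted hc ht hWm (hg2 l)).mono
        (h.chain.pastSigma_le _) le_rfl).indicator
        (h.chain.measurableSet_eq (by linarith [hg2 l]) j)).aestronglyMeasurable
      (Eventually.of_forall fun ω => (norm_indicator_le_norm_self _ ω).trans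
        (abs_discounted_le h.lam_nonneg hc ht hWb (hg2 l) ω))
    obtain ⟨K, hK0, hK⟩ := h.chain.exists_cumIntensity_le h.lam_nonneg hγ'
      (t + gridPoint a b k ((l : ℝ) + 1))
    refine Integrable.of_bound (C := K * (t + gridPoint a b k ((l : ℝ) + 1) -
      (t + gridPoint a b k l)))
      ((h.chain.measurable_cumIntensity lam hγ' (by linarith [hg0 l]) (by linarith [hg1 l])).mono
        (h.chain.pastSigma_le _) le_rfl).aestronglyMeasurable
      (Eventually.of_forall fun ω => ?_)
    rw [Real.norm_of_nonneg (cumIntensity_nonneg h.lam_nonneg hγ' (by linarith [hg0 l])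
      (by linarith [hg1 l]) ω)]
    exact hK _ _ ω (by linarith [hg0 l]) (by linarith [hg1 l]) le_rfl
  -- Distinct cells are incompatible: after a count `n + 1` at the end of one cell, monotonicity
  -- forbids the count `n` at the start of a later one.
  · intro l hl m hm hlm
    have key : ∀ l m : ℕ, l < m → ∀ ω, N (t + gridPoint a b k ((l : ℝ) + 1)) ω = n + 1 →
        N (t + gridPoint a b k m) ω = n → False := by
      intro l m hlm ω h1 h2
      have h3 : gridPoint a b k ((l : ℝ) + 1) ≤ gridPoint a b k m :=
        gridPoint_mono hab (by exact_mod_cast hlm)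
      have h4 := h.mono ω (t + gridPoint a b k ((l : ℝ) + 1)) (t + gridPoint a b k m)
        (by linarith [hg2 l]) (by linarith)
      omega
    refine Set.disjoint_left.2 fun ω h1 h2 => ?_
    rcases lt_or_gt_of_ne hlm with hlt | hlt
    · exact key l m hlt ω h1.2.2.1 h2.2.1
    · exact key m l hlt ω h2.2.2.1 h1.2.1
  · intro l hl
    exact (h.measurableSet_stateEvent ht i n).inter
      (h.measurableSet_gridCell (by linarith [hg0 l]) (by linarith [hg2 l]) j n)

/-- Both sides of `measureReal_gridArrivalEvent` pass to the limit of fine grids. Where the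
indicator of `{M (t + u) = j}` is nonzero the rate is the constant `c * lam j`, so Fubini leaves the
time integral of `discountedMean`. -/
theorem measureReal_nextArrivalEvent_Ioc [IsProbabilityMeasure μ] (h : IsMMNPP μ Q lam γ M N)
    {t a b c : ℝ} (ht : 0 ≤ t) (ha : 0 ≤ a) (hab : a < b) (hc : 0 ≤ c)
    (hγ : IsExposure γ) (hγc : ∀ u ∈ Ico t (t + b), γ u = c) (i j : Fin r) (n : ℕ) :
    μ.real (stateEvent M N t i n ∩ nextArrivalEvent M N t (Ioc a b) j) =
      ∫ u in a..b, discountedMean μ M lam c t (stateWeight M lam γ t i n) u j * (c * lam j) := by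
  have hWm := h.measurable_stateWeight hγ ht i n
  have hWb := h.abs_stateWeight_le hγ ht i n
  have hγ' := IsExposure.const hc
  set φ : ℝ → Ω → ℝ := fun u =>
    {ω | M (t + u) ω = j}.indicator (discounted M lam c t (stateWeight M lam γ t i n) u) with hφ
  have hφm : ∀ u, 0 ≤ u → Measurable (φ u) := fun u hu =>
    ((h.chain.measurable_discounted hc ht hWm hu).mono (h.chain.pastSigma_le _) le_rfl).indicator
      (h.chain.measurableSet_eq (by linarith) j)
  have hφb : ∀ u, 0 ≤ u → ∀ ω, |φ u ω| ≤ 1 := fun u hu ω =>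
    (norm_indicator_le_norm_self (discounted M lam c t (stateWeight M lam γ t i n) u) ω).trans
      (abs_discounted_le h.lam_nonneg hc ht hWb hu ω)
  have hφr : ∀ u, 0 ≤ u → ∀ ω, Tendsto (fun v => φ v ω) (𝓝[≥] u) (𝓝 (φ u ω)) :=
    fun u hu ω => h.chain.tendsto_indicator_discounted h.lam_nonneg hc ht hu j ω
  have hφ_int : ∀ u, 0 ≤ u → ∫ ω, φ u ω ∂μ =
      discountedMean μ M lam c t (stateWeight M lam γ t i n) u j := fun u hu =>
    integral_indicator (h.chain.measurableSet_eq (by linarith) j)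
  have hpath : ∀ ω, IntervalIntegrable (fun u => lam (M (t + u) ω) * c) volume a b := fun ω => by
    have h1 := (h.chain.intervalIntegrable_path_mul h.lam_nonneg hγ' (by linarith : 0 ≤ t + a)
      (by linarith : t + a ≤ t + b) ω).comp_add_left t
    simpa using h1
  obtain ⟨K, hK0, hK⟩ := h.chain.exists_cumIntensity_le h.lam_nonneg hγ' (t + b)
  have hg0 : ∀ k l : ℕ, 0 ≤ gridPoint a b k l := fun k l =>
    ha.trans (le_gridPoint_natCast hab.le k l)
  have hg1 : ∀ k l : ℕ, gridPoint a b k l ≤ gridPoint a b k ((l : ℝ) + 1) := fun k l =>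
    gridPoint_mono hab.le (by linarith)
  have hinner : ∀ (k l : ℕ) (ω : Ω),
      ∫ u in (gridPoint a b k l)..(gridPoint a b k ((l : ℝ) + 1)), lam (M (t + u) ω) * c =
      cumIntensity lam (fun _ => c) M (t + gridPoint a b k l)
        (t + gridPoint a b k ((l : ℝ) + 1)) ω := fun k l ω =>
    intervalIntegral.integral_comp_add_left (fun u => lam (M u ω) * c) t
  have hlim : Tendsto (fun k => ∫ ω, ∑ l ∈ Finset.range (k + 1),
        φ (gridPoint a b k ((l : ℝ) + 1)) ω *
        (∫ u in (gridPoint a b k l)..(gridPoint a b k ((l : ℝ) + 1)), lam (M (t + u) ω) * c) ∂μ)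
      atTop (𝓝 (∫ ω, (∫ u in a..b, φ u ω * (lam (M (t + u) ω) * c)) ∂μ)) := by
    refine tendsto_integral_filter_of_dominated_convergence (fun _ => K * (b - a))
      (Eventually.of_forall fun k => ?_)
      (Eventually.of_forall fun k => Eventually.of_forall fun ω => ?_) (integrable_const _)
      (Eventually.of_forall fun ω => ?_)
    · refine (Finset.measurable_sum _ fun l _ => Measurable.mul
        (hφm _ ((hg0 k l).trans (hg1 k l))) ?_).aestronglyMeasurable
      simp_rw [hinner]
      exact (h.chain.measurable_cumIntensity lam hγ' (by linarith [hg0 k l])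
        (by linarith [hg1 k l])).mono (h.chain.pastSigma_le _) le_rfl
    · have hterm : ∀ l ∈ Finset.range (k + 1), |φ (gridPoint a b k ((l : ℝ) + 1)) ω *
          ∫ u in (gridPoint a b k l)..(gridPoint a b k ((l : ℝ) + 1)), lam (M (t + u) ω) * c| ≤
          K * (b - a) / ((k : ℝ) + 1) := by
        -- The cells have equal length `(b - a) / (k + 1)`, so the `k + 1` terms together are
        -- bounded by `K * (b - a)` uniformly in `k`.
        intro l hl
        have h0 := cumIntensity_nonneg (M := M) h.lam_nonneg hγ'
          (by linarith [hg0 k l] : 0 ≤ t + gridPoint a b k l)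
          (by linarith [hg1 k l] : t + gridPoint a b k l ≤ t + gridPoint a b k ((l : ℝ) + 1)) ω
        have h1 := hK (t + gridPoint a b k l) (t + gridPoint a b k ((l : ℝ) + 1)) ω
          (by linarith [hg0 k l]) (by linarith [hg1 k l])
          (by linarith [gridPoint_natCast_add_one_le hab.le hl])
        have e : K * (t + gridPoint a b k ((l : ℝ) + 1) - (t + gridPoint a b k l)) =
            K * (b - a) / ((k : ℝ) + 1) := by
          simp only [gridPoint]; ring
        rw [hinner, abs_mul, abs_of_nonneg h0, ← e]
        exact (mul_le_of_le_one_left h0 (hφb _ ((hg0 k l).trans (hg1 k l)) ω)).trans h1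
      refine (Finset.abs_sum_le_sum_abs _ _).trans ((Finset.sum_le_sum hterm).trans (le_of_eq ?_))
      have : (k : ℝ) + 1 ≠ 0 := by positivity
      simp only [Finset.sum_const, Finset.card_range, nsmul_eq_mul]
      push_cast
      field_simp
    · exact tendsto_sum_gridPoint_mul_integral (φ := fun u => φ u ω) (C := 1) hab.le
        (fun u hu => hφr u (ha.trans hu.1.le) ω) (fun u hu => hφb u (ha.trans hu.1.le) ω)
        (hpath ω)
  have hlim' := h.tendsto_measureReal_gridArrivalEvent ht ha hab i j n
  rw [tendsto_nhds_unique hlim' (hlim.congr fun k =>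
    (h.measureReal_gridArrivalEvent ht ha hab.le hc hγ hγc i j n k).symm)]
  -- The clamp `max u 0` extends `φ` to negative times, where measurability and right continuity are
  -- not assumed; it changes nothing on `[a, b]`.
  have hprod : Integrable (Function.uncurry fun (u : ℝ) ω => φ (max u 0) ω)
      ((volume.restrict (uIoc a b)).prod μ) := by
    have hjm : Measurable (Function.uncurry fun (u : ℝ) ω => φ (max u 0) ω) :=
      measurable_uncurry_of_rightCont (fun u => hφm _ (le_max_right _ _)) fun ω u => by
        refine (hφr _ (le_max_right u 0) ω).comp (tendsto_nhdsWithin_iff.2 ⟨?_, ?_⟩)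
        · have : Continuous fun v : ℝ => max v 0 := by fun_prop
          exact (this.tendsto u).mono_left nhdsWithin_le_nhds
        · filter_upwards [self_mem_nhdsWithin] with v hv
          exact max_le_max_right _ (mem_Ioi.1 hv).le
    have : IsFiniteMeasure (volume.restrict (uIoc a b)) := by
      rw [uIoc_of_le hab.le]; infer_instance
    exact Integrable.of_bound (C := 1) hjm.aestronglyMeasurable
      (Eventually.of_forall fun p => hφb _ (le_max_right _ _) _)
  calc ∫ ω, (∫ u in a..b, φ u ω * (lam (M (t + u) ω) * c)) ∂μ
      = ∫ ω, (∫ u in a..b, φ (max u 0) ω) * (c * lam j) ∂μ := by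
        refine integral_congr_ae (Eventually.of_forall fun ω => ?_)
        simp only [← intervalIntegral.integral_mul_const]
        refine intervalIntegral.integral_congr fun u hu => ?_
        rw [uIcc_of_le hab.le] at hu
        simp only [max_eq_left (ha.trans hu.1), hφ, indicator]
        split_ifs with hj
        · have hj' : M (t + u) ω = j := hj
          rw [hj']; ring
        · simp
    _ = (∫ u in a..b, ∫ ω, φ (max u 0) ω ∂μ) * (c * lam j) := by
        rw [integral_mul_const, intervalIntegral_integral_swap hprod]
    _ = ∫ u in a..b, discountedMean μ M lam c t (stateWeight M lam γ t i n) u j *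
          (c * lam j) := by
        rw [← intervalIntegral.integral_mul_const]
        refine intervalIntegral.integral_congr fun u hu => ?_
        rw [uIcc_of_le hab.le] at hu
        simp only [max_eq_left (ha.trans hu.1), hφ_int u (ha.trans hu.1)]

end IsMMNPP

/-! ### From intervals to Borel sets. -/

namespace IsMMNPP

variable {Ω : Type*} [mΩ : MeasurableSpace Ω] {μ : Measure Ω} {r : ℕ}
  {Q : Matrix (Fin r) (Fin r) ℝ} {lam : Fin r → ℝ} {γ : ℝ → ℝ} {M : ℝ → Ω → Fin r}
  {N : ℝ → Ω → ℕ}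

/-- The first arrival time after `t`, seen from `t`, as a random variable. -/
theorem exists_arrivalTime (h : IsMMNPP μ Q lam γ M N) {t b : ℝ} (ht : 0 ≤ t) (i j : Fin r)
    (n : ℕ) : ∃ τ : Ω → ℝ, Measurable τ ∧ ∀ B ⊆ Ioc 0 b,
      stateEvent M N t i n ∩ nextArrivalEvent M N t B j =
        (stateEvent M N t i n ∩ nextArrivalEvent M N t (Ioc 0 b) j) ∩ τ ⁻¹' B := by
  classical
  set E := stateEvent M N t i n ∩ nextArrivalEvent M N t (Ioc 0 b) j with hE
  have hEm : MeasurableSet E := h.measurableSet_nextArrivalEvent_Ioc ht le_rfl i j n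
  -- The default value `0` off `E` puts the complement of `E` inside `{τ ≤ x}` exactly when `x ≥ 0`,
  -- which governs the case split in the measurability proof.
  set τ : Ω → ℝ := fun ω => if hω : ω ∈ E then hω.2.choose else 0 with hτ
  have hspec : ∀ ω ∈ E, τ ω ∈ Ioc 0 b ∧ (∀ u ∈ Ico t (t + τ ω), N u ω = N t ω) ∧
      N (t + τ ω) ω = N t ω + 1 ∧ M (t + τ ω) ω = j := by
    intro ω hω
    have := hω.2.choose_spec
    simpa only [hτ, dif_pos hω] using this
  have huniq : ∀ ω ∈ E, ∀ s, 0 < s → (∀ u ∈ Ico t (t + s), N u ω = N t ω) →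
      N (t + s) ω = N t ω + 1 → s = τ ω := by
    intro ω hω s hs h1 h2
    obtain ⟨h3, h4, h5, -⟩ := hspec ω hω
    rcases lt_trichotomy s (τ ω) with hlt | heq | hlt
    · have := h4 (t + s) ⟨by linarith, by linarith⟩
      omega
    · exact heq
    · have := h1 (t + τ ω) ⟨by linarith [h3.1], by linarith⟩
      omega
  have hsets : ∀ B ⊆ Ioc 0 b,
      stateEvent M N t i n ∩ nextArrivalEvent M N t B j = E ∩ τ ⁻¹' B := by
    intro B hB
    ext ω
    constructor
    · rintro ⟨h1, s, hs, h2, h3, h4⟩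
      have hω : ω ∈ E := ⟨h1, s, hB hs, h2, h3, h4⟩
      refine ⟨hω, ?_⟩
      rw [mem_preimage, ← huniq ω hω s (hB hs).1 h2 h3]
      exact hs
    · rintro ⟨hω, h1⟩
      exact ⟨hω.1, τ ω, h1, (hspec ω hω).2⟩
  refine ⟨τ, measurable_of_Iic fun x => ?_, hsets⟩
  have hτE : ∀ ω ∉ E, τ ω = 0 := fun ω hω => by simp only [hτ, dif_neg hω]
  rcases lt_or_ge x 0 with hx | hx
  · have : τ ⁻¹' Iic x = ∅ := by
      ext ω
      simp only [mem_preimage, mem_Iic, mem_empty_iff_false, iff_false, not_le]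
      by_cases hω : ω ∈ E
      · exact hx.trans (hspec ω hω).1.1
      · rw [hτE ω hω]; exact hx
    rw [this]
    exact MeasurableSet.empty
  · have : τ ⁻¹' Iic x = Eᶜ ∪
        (stateEvent M N t i n ∩ nextArrivalEvent M N t (Ioc 0 (min x b)) j) := by
      rw [hsets _ (Ioc_subset_Ioc_right (min_le_right _ _))]
      ext ω
      simp only [mem_preimage, mem_Iic, mem_union, mem_compl_iff, mem_inter_iff, mem_Ioc,
        le_min_iff]
      by_cases hω : ω ∈ E
      · have := (hspec ω hω).1
        simp only [hω, this.1, this.2]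
        tauto
      · simp [hω, hτE ω hω, hx]
    rw [this]
    exact hEm.compl.union (h.measurableSet_nextArrivalEvent_Ioc ht le_rfl i j n)

/-- As functions of `B`, both sides come from measures on the line: the image under the arrival time
of `μ` restricted to `E`, and the measure with density `f` on `(0, b]`. They agree on half-open
intervals, truncated to `(0, b]`, hence on all Borel sets. -/
theorem measureReal_nextArrivalEvent [IsProbabilityMeasure μ] (h : IsMMNPP μ Q lam γ M N)
    {t b c : ℝ} (ht : 0 ≤ t) (hc : 0 ≤ c) (hγ : IsExposure γ)
    (hγc : ∀ u ∈ Ico t (t + b), γ u = c) (i j : Fin r) (n : ℕ) {B : Set ℝ}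
    (hBm : MeasurableSet B) (hB : B ⊆ Ioc 0 b) :
    μ.real (stateEvent M N t i n ∩ nextArrivalEvent M N t B j) =
      ∫ u in B, discountedMean μ M lam c t (stateWeight M lam γ t i n) u j * (c * lam j) := by
  obtain ⟨τ, hτm, hτ⟩ := h.exists_arrivalTime (b := b) ht i j n
  set E := stateEvent M N t i n ∩ nextArrivalEvent M N t (Ioc 0 b) j with hE
  have hEm : MeasurableSet E := h.measurableSet_nextArrivalEvent_Ioc ht le_rfl i j n
  set f : ℝ → ℝ := fun u =>
    discountedMean μ M lam c t (stateWeight M lam γ t i n) u j * (c * lam j) with hf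
  obtain ⟨P, hT, hP⟩ := h.chain.markov
  have hcont : ContinuousOn f (Icc 0 b) :=
    (h.chain.continuousOn_discountedMean hT hP h.lam_nonneg hc ht
      (h.measurable_stateWeight hγ ht i n) (h.abs_stateWeight_le hγ ht i n) b j).mul
      continuousOn_const
  have hfi : IntegrableOn f (Ioc 0 b) :=
    hcont.integrableOn_Icc.mono_set Ioc_subset_Icc_self
  have hf0 : ∀ u ∈ Ioc 0 b, 0 ≤ f u := by
    intro u hu
    refine mul_nonneg ?_ (mul_nonneg hc (h.lam_nonneg j))
    rw [← h.measureReal_state_survival ht hu.1.le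
      (fun v hv => hγc v ⟨hv.1, by linarith [hv.2, hu.2]⟩)]
    exact measureReal_nonneg
  set ν₁ : Measure ℝ := (μ.restrict E).map τ with hν₁
  set ν₂ : Measure ℝ := (volume.restrict (Ioc 0 b)).withDensity fun u => ENNReal.ofReal (f u)
    with hν₂
  have hν₁_apply : ∀ C, MeasurableSet C → ν₁ C = μ (E ∩ τ ⁻¹' C) := fun C hC => by
    rw [hν₁, Measure.map_apply hτm hC, Measure.restrict_apply (hτm hC), inter_comm]
  have hν₂_apply : ∀ C, MeasurableSet C → ν₂ C = ENNReal.ofReal (∫ u in C ∩ Ioc 0 b, f u) := by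
    intro C hC
    rw [hν₂, withDensity_apply _ hC, Measure.restrict_restrict hC,
      ofReal_integral_eq_lintegral_ofReal (hfi.mono_set inter_subset_right)]
    filter_upwards [ae_restrict_mem (hC.inter measurableSet_Ioc)] with u hu using hf0 u hu.2
  have heq : ν₁ = ν₂ := by
    refine Measure.ext_of_Ioc _ _ fun x y _ => ?_
    rw [hν₁_apply _ measurableSet_Ioc, hν₂_apply _ measurableSet_Ioc, Ioc_inter_Ioc]
    have e : E ∩ τ ⁻¹' Ioc x y =
        stateEvent M N t i n ∩ nextArrivalEvent M N t (Ioc (max x 0) (min y b)) j := by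
      rw [← Ioc_inter_Ioc, hτ _ inter_subset_right, preimage_inter]
      have hsub : E ⊆ τ ⁻¹' Ioc 0 b := fun ω hω => by
        have h1 := hτ (Ioc 0 b) subset_rfl
        rw [← hE] at h1
        exact (h1 ▸ hω : ω ∈ E ∩ τ ⁻¹' Ioc 0 b).2
      rw [inter_comm (τ ⁻¹' Ioc x y), ← inter_assoc, inter_eq_left.2 hsub]
    rw [e, ← ofReal_measureReal]
    rcases lt_or_ge (max x 0) (min y b) with hlt | hle
    · rw [h.measureReal_nextArrivalEvent_Ioc ht (le_max_right _ _) hlt hc hγ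
        (fun u hu => hγc u ⟨hu.1, by linarith [hu.2, min_le_right y b]⟩),
        intervalIntegral.integral_of_le hlt.le]
    · simp [nextArrivalEvent, Ioc_eq_empty_of_le hle]
  rw [hτ B hB, measureReal_def, ← hν₁_apply B hBm, heq, hν₂_apply B hBm, inter_eq_left.2 hB,
    ENNReal.toReal_ofReal (setIntegral_nonneg hBm fun u hu => hf0 u (hB hu))]

theorem cond_nextArrivalEvent [IsProbabilityMeasure μ] (h : IsMMNPP μ Q lam γ M N)
    {t tstar c : ℝ} (ht : 0 ≤ t) (hc : 0 ≤ c) (hγ : IsExposure γ)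
    (hγc : ∀ u ∈ Ico t (t + tstar), γ u = c) {i : Fin r} (j : Fin r) {n : ℕ}
    (hpos : μ (stateEvent M N t i n) ≠ 0) {B : Set ℝ}
    (hBm : MeasurableSet B) (hB : B ⊆ Ioc 0 tstar) :
    (ProbabilityTheory.cond μ (stateEvent M N t i n)).real (nextArrivalEvent M N t B j) =
      ∫ s in B, mmnppDensity Q lam c (γ (t + s)) s i j := by
  have hp : μ.real (stateEvent M N t i n) ≠ 0 := (measureReal_ne_zero_iff).2 hpos
  rw [measureReal_cond (h.measurableSet_stateEvent ht i n),
    h.measureReal_nextArrivalEvent ht hc hγ hγc i j n hBm hB, ← integral_const_mul]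
  refine setIntegral_congr_ae hBm ?_
  -- The exposure `γ (t + u)` may differ from `c` only at `u = tstar`, a null set.
  filter_upwards [Measure.ae_ne volume tstar] with u hne hu
  have hu' := hB hu
  have hγu : γ (t + u) = c :=
    hγc _ ⟨by linarith [hu'.1], by linarith [lt_of_le_of_ne hu'.2 hne]⟩
  rw [h.discountedMean_stateWeight hγ ht hu'.1.le hc, mmnppDensity_apply, hγu, ← mul_assoc,
    inv_mul_cancel_left₀ hp]

end IsMMNPP

theorem theorem3 {Ω : Type*} [MeasurableSpace Ω] (μ : Measure Ω) [IsProbabilityMeasure μ]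
    {r : ℕ} (Q : Matrix (Fin r) (Fin r) ℝ) (lam : Fin r → ℝ) (γ : ℝ → ℝ)
    (M : ℝ → Ω → Fin r) (N : ℝ → Ω → ℕ)
    (hγ_nonneg : ∀ u, 0 ≤ u → 0 ≤ γ u)
    (hγ_bv : LocallyBoundedVariationOn γ (Ici 0))
    (hMN : IsMMNPP μ Q lam γ M N)
    (t tstar c : ℝ) (ht : 0 ≤ t) (htstar : 0 < tstar)
    (hγ_const : ∀ u ∈ Ico t (t + tstar), γ u = c)
    (hγ_end : ContinuousWithinAt γ (Ici (t + tstar)) (t + tstar))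
    (i j : Fin r) (n : ℕ) (hpos : μ (stateEvent M N t i n) ≠ 0) :
    -- law of (time of the next arrival, regime at that arrival), given the state at time `t`
    (∀ B : Set ℝ, MeasurableSet B → B ⊆ Ioc 0 tstar →
      (ProbabilityTheory.cond μ (stateEvent M N t i n)).real (nextArrivalEvent M N t B j) =
        ∫ s in B, mmnppDensity Q lam c (γ (t + s)) s i j) ∧
    -- value of the density at `tstar`, as a limit of joint probabilities
    Tendsto (fun h : ℝ =>
        (ProbabilityTheory.cond μ (stateEvent M N t i n)).real
          (leftCountEvent N (t + tstar) n ∩ stateEvent M N (t + tstar + h) j (n + 1)) / h)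
      (𝓝[>] 0) (𝓝 (mmnppDensity Q lam c (γ (t + tstar)) tstar i j)) ∧
    -- the same value, as (probability of no arrival before `t + tstar`) times (arrival rate)
    Tendsto (fun h : ℝ =>
        (ProbabilityTheory.cond μ (stateEvent M N t i n)).real
          ({ω | M (t + tstar) ω = j} ∩ leftCountEvent N (t + tstar) n) *
        ((ProbabilityTheory.cond μ
            ({ω | M (t + tstar) ω = j} ∩ leftCountEvent N (t + tstar) n)).real
          (stateEvent M N (t + tstar + h) j (n + 1)) / h))
      (𝓝[>] 0) (𝓝 (mmnppDensity Q lam c (γ (t + tstar)) tstar i j)) := by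
  have hγ := hγ_bv.isExposure hγ_nonneg
  have hc : 0 ≤ c := by
    rw [← hγ_const t ⟨le_rfl, by linarith⟩]
    exact hγ_nonneg t ht
  exact ⟨fun B hBm hB => hMN.cond_nextArrivalEvent ht hc hγ hγ_const j hpos hBm hB,
    hMN.tendsto_cond_arrival hγ ht htstar hc hγ_const hγ_end hpos,
    hMN.tendsto_cond_survival_mul_arrival hγ ht htstar hc hγ_const hγ_end hpos⟩
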